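/- Let $(\Omega,\mathcal F,P)$ be a probability space, $L^0(\mathcal F)$ (resp. $\bar L^0(\mathcal F)$) the set of real (resp. extended real) valued random variables modulo almost sure equality. $\bar L^0(\mathcal F)$ is a complete lattice for the almost sure order; $\bigvee$ denotes suprema in it and $\tilde I_A$ the class of the indicator of $A\in\mathcal F$; $0\cdot(\pm\infty)=0$. A relation holds on $A$ if it holds at almost every point of $A$. Let $(E,\mathcal P)$ be a random locally convex (RLC) module over $\mathbb R$ with base $(\Omega,\mathcal F,P)$: $E$ is an $L^0(\mathcal F)$-module and $\mathcal P$ is a family of maps $\|\cdot\|:E\to L^0(\mathcal F)$ with $\|x\|\ge 0$, $\|\xi x\|=|\xi|\,\|x\|$ and $\|x+y\|\le\|x\|+\|y\|$ for $\xi\in L^0(\mathcal F)$, $x,y\in E$, such that $x=0$ if and only if $\|x\|=0$ for all $\|\cdot\|\in\mathcal P$. The $(\varepsilon,\lambda)$-topology $\mathcal T_{\varepsilon,\lambda}$ on $E$ has as local base at $0$ the sets $\{x\in E: P(\max_{\|\cdot\|\in\mathcal Q}\|x\|<\varepsilon)>1-\lambda\}$ with $\mathcal Q\subset\mathcal P$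 finite, $\varepsilon>0$, $0<\lambda<1$; on $L^0(\mathcal F)$ it is the one induced by $|\cdot|$ (convergence in probability). Let $E^*_{\varepsilon,\lambda}$ be the set of continuous $L^0(\mathcal F)$-linear maps $(E,\mathcal T_{\varepsilon,\lambda})\to(L^0(\mathcal F),\mathcal T_{\varepsilon,\lambda})$. A function $f:E\to\bar L^0(\mathcal F)$ is local if $\tilde I_Af(x)=\tilde I_Af(\tilde I_Ax)$ for all $x\in E$, $A\in\mathcal F$. For such $f$ put $$f^*_{\varepsilon,\lambda}(g)=\bigvee_{x\in E}\bigl(g(x)-f(x)\bigr)\ (g\in E^*_{\varepsilon,\lambda}),\qquad f^{**}_{\varepsilon,\lambda}(x)=\bigvee_{g\in E^*_{\varepsilon,\lambda}}\bigl(g(x)-f^*_{\varepsilon,\lambda}(g)\bigr)\ (x\in E).$$ Let $MI(f)$ be the essential supremum of the sets $A\in\mathcal F$ such that $f(x)=-\infty$ on $A$ for some $x\in E$, $PI(f)$ the essential supremum of the sets $A\in\mathcal F$ such that $f(x)=+\infty$ on $A$ for all $x\in E$, and $BP(f)=\Omega\setminus(MI(f)\cup PI(f))$. For $A\in\mathcal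 F$ let $E^A=\tilde I_AE$ and let $f_A$ be the restriction of $\tilde I_Af$ to $E^A$. Call $f_A$ proper if $f_A(x)>-\infty$ on $A$ for all $x\in E^A$ and $f_A(x)<+\infty$ on $A$ for some $x\in E^A$; $L^0$-convex if $f_A(\xi x+(1-\xi)y)\le\xi f_A(x)+(1-\xi)f_A(y)$ on $A$ for all $x,y\in E^A$ and $\xi\in L^0(\mathcal F)$ with $0\le\xi\le1$; and $\mathcal T_{\varepsilon,\lambda}$-lower semicontinuous if its epigraph $\{(x,r)\in E^A\times\tilde I_AL^0(\mathcal F): f_A(x)\le r\}$ is closed in $E^A\times\tilde I_AL^0(\mathcal F)$ for the product of the $(\varepsilon,\lambda)$-topologies. A local function $f$ is $\mathcal T_{\varepsilon,\lambda}$-closed if $f(x)=-\infty$ on $MI(f)$ for all $x\in E$, and $f_A$ is $L^0$-convex and $\mathcal T_{\varepsilon,\lambda}$-lower semicontinuous for every $A\in\mathcal F$ with $A\subset BP(f)$ and $P(A)>0$ such that $f_A$ is proper. The closure $Cl_{\varepsilon,\lambda}(f)$ is the greatest $\mathcal T_{\varepsilon,\lambda}$-closed function $h$ with $h(x)\le f(x)$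 for all $x\in E$. **Theorem.** For every RLC module $(E,\mathcal P)$ over $\mathbb R$ with base $(\Omega,\mathcal F,P)$ and every local function $f:E\to\bar L^0(\mathcal F)$, the closure $Cl_{\varepsilon,\lambda}(f)$ exists and $$f^{**}_{\varepsilon,\lambda}=Cl_{\varepsilon,\lambda}(f).$$ -/

import Mathlib

open MeasureTheory

noncomputable section

namespace RLC

/-- `L⁰(𝓕)`: classes of real random variables modulo almost sure equality. -/
abbrev L0 {Ω : Type*} [MeasurableSpace Ω] (P : Measure Ω) := Ω →ₘ[P] ℝ

/-- `L̄⁰(𝓕)`: classes of extended real random variables modulo almost sure equality, with the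
almost sure order. -/
abbrev L0bar {Ω : Type*} [MeasurableSpace Ω] (P : Measure Ω) := Ω →ₘ[P] EReal

section Base

variable {Ω : Type*} [MeasurableSpace Ω] {P : Measure Ω}

theorem L0.left_distrib' (a b c : L0 P) : a * (b + c) = a * b + a * c := by
  apply AEEqFun.ext
  filter_upwards [AEEqFun.coeFn_mul a (b + c), AEEqFun.coeFn_add b c,
    AEEqFun.coeFn_add (a * b) (a * c), AEEqFun.coeFn_mul a b, AEEqFun.coeFn_mul a c]
    with ω h1 h2 h3 h4 h5
  simp only [h1, h2, h3, h4, h5, Pi.mul_apply, Pi.add_apply, mul_add]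

theorem L0.zero_mul' (a : L0 P) : 0 * a = 0 := by
  apply AEEqFun.ext
  filter_upwards [AEEqFun.coeFn_mul 0 a, AEEqFun.coeFn_zero (α := Ω) (μ := P) (β := ℝ)]
    with ω h1 h2
  simp only [h1, h2, Pi.mul_apply, Pi.zero_apply, zero_mul]

/-- The pointwise ring structure of `L⁰(𝓕)`. -/
instance L0.instCommRing : CommRing (L0 P) :=
  { (inferInstance : AddCommGroup (L0 P)), (inferInstance : CommMonoid (L0 P)) with
    left_distrib := L0.left_distrib'
    right_distrib := fun a b c => by
      rw [mul_comm (a + b) c, mul_comm a c, mul_comm b c, L0.left_distrib']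
    zero_mul := L0.zero_mul'
    mul_zero := fun a => by rw [mul_comm, L0.zero_mul'] }

/-- `Ĩ_A`, the class of the indicator of the measurable set `A`. -/
def ind (P : Measure Ω) {A : Set Ω} (hA : MeasurableSet A) : L0 P :=
  AEEqFun.mk (A.indicator fun _ => (1 : ℝ))
    ((stronglyMeasurable_const.indicator hA).aestronglyMeasurable)

/-- `ξ - η` for `ξ ∈ L⁰` and `η ∈ L̄⁰`; since `ξ` is finite, no indeterminate form occurs. -/
def realSub (ξ : L0 P) (η : L0bar P) : L0bar P :=
  AEEqFun.comp₂Measurable (fun (a : ℝ) (b : EReal) => (a : EReal) - b)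
    (by
      simp only [Function.uncurry_def, sub_eq_add_neg]
      fun_prop) ξ η

/-- `(L̄⁰(𝓕), ≤)` is a complete lattice. -/
theorem exists_isLUB_L0bar [IsFiniteMeasure P] (S : Set (L0bar P)) : ∃ η : L0bar P, IsLUB S η := by
  classical
  rcases S.eq_empty_or_nonempty with rfl | ⟨s₀, hs₀⟩
  · refine ⟨AEEqFun.const Ω ⊥, by simp, fun η _ => ?_⟩
    rw [← AEEqFun.coeFn_le]
    filter_upwards [AEEqFun.coeFn_const (μ := P) Ω (⊥ : EReal)] with ω h
    rw [h]; exact bot_le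
  -- a bounded strictly increasing measurable function on the extended reals
  let ψ : EReal → ENNReal := fun x =>
    ENNReal.ofReal (ENNReal.orderIsoUnitIntervalBirational (EReal.expOrderIso x) : ℝ)
  have hψs : StrictMono ψ := by
    intro a b hab
    have h1 : ENNReal.orderIsoUnitIntervalBirational (EReal.expOrderIso a)
        < ENNReal.orderIsoUnitIntervalBirational (EReal.expOrderIso b) := by simpa using hab
    have h0 : (0 : ℝ) ≤ (ENNReal.orderIsoUnitIntervalBirational (EReal.expOrderIso a) : ℝ) :=
      (ENNReal.orderIsoUnitIntervalBirational (EReal.expOrderIso a)).2.1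
    have h2 : (ENNReal.orderIsoUnitIntervalBirational (EReal.expOrderIso a) : ℝ)
        < (ENNReal.orderIsoUnitIntervalBirational (EReal.expOrderIso b) : ℝ) := h1
    exact (ENNReal.ofReal_lt_ofReal_iff (h0.trans_lt h2)).2 h2
  have hψm : Measurable ψ := hψs.monotone.measurable
  have hψ1 : ∀ x, ψ x ≤ 1 := fun x =>
    ENNReal.ofReal_le_one.2 (ENNReal.orderIsoUnitIntervalBirational (EReal.expOrderIso x)).2.2
  let J : (ℕ → S) → ENNReal := fun u => ∫⁻ ω, ψ (⨆ n, (u n : L0bar P) ω) ∂P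
  let c : ENNReal := ⨆ u, J u
  have hne : Nonempty (ℕ → S) := ⟨fun _ => ⟨s₀, hs₀⟩⟩
  have hm : ∀ u : ℕ → S, Measurable fun ω => ⨆ n, (u n : L0bar P) ω := fun u =>
    Measurable.iSup fun n => (u n : L0bar P).stronglyMeasurable.measurable
  obtain ⟨t, -, htlim, htmem⟩ := exists_seq_tendsto_sSup (S := Set.range J)
    (Set.range_nonempty J) (OrderTop.bddAbove _)
  choose v hv using htmem
  let w : ℕ → S := fun n => v (Nat.unpair n).1 (Nat.unpair n).2
  have hle : ∀ u, J u ≤ J w := by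
    have h1 : ∀ k, t k ≤ J w := by
      intro k
      rw [← hv k]
      refine lintegral_mono fun ω => hψs.monotone (iSup_le fun n => ?_)
      refine le_iSup_of_le (Nat.pair k n) ?_
      simp [w]
    intro u
    exact (le_sSup (Set.mem_range_self u)).trans (le_of_tendsto' htlim h1)
  refine ⟨AEEqFun.mk (fun ω => ⨆ n, (w n : L0bar P) ω) (hm w).aestronglyMeasurable, ?_, ?_⟩
  · intro s hs
    rw [← AEEqFun.coeFn_le]
    let w' : ℕ → S := fun n => if n = 0 then ⟨s, hs⟩ else w (n - 1)
    have hmono : ∀ ω, ⨆ n, (w n : L0bar P) ω ≤ ⨆ n, (w' n : L0bar P) ω := fun ω =>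
      iSup_le fun n => le_iSup (fun n => (w' n : L0bar P) ω) (n + 1)
    have hfin : J w ≠ ⊤ := by
      refine ne_top_of_le_ne_top (measure_ne_top P Set.univ) ?_
      calc J w ≤ ∫⁻ _, 1 ∂P := lintegral_mono fun ω => hψ1 _
        _ = P Set.univ := by simp
    have heq := ae_eq_of_ae_le_of_lintegral_le
      (Filter.Eventually.of_forall fun ω => hψs.monotone (hmono ω)) hfin
      (hψm.comp (hm w')).aemeasurable (hle w')
    filter_upwards [heq, AEEqFun.coeFn_mk (μ := P) (fun ω => ⨆ n, (w n : L0bar P) ω)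
      (hm w).aestronglyMeasurable] with ω h1 h2
    rw [h2, hψs.injective h1]
    exact le_iSup (fun n => (w' n : L0bar P) ω) 0
  · intro η hη
    rw [← AEEqFun.coeFn_le]
    have hall : ∀ᵐ ω ∂P, ∀ n, (w n : L0bar P) ω ≤ η ω :=
      ae_all_iff.2 fun n => AEEqFun.coeFn_le.2 (hη (w n).2)
    filter_upwards [hall, AEEqFun.coeFn_mk (μ := P) (fun ω => ⨆ n, (w n : L0bar P) ω)
      (hm w).aestronglyMeasurable] with ω h1 h2
    rw [h2]
    exact iSup_le h1

/-- The supremum `⋁ S` in the complete lattice `L̄⁰(𝓕)`. -/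
def sup [IsFiniteMeasure P] (S : Set (L0bar P)) : L0bar P := (exists_isLUB_L0bar S).choose

theorem isLUB_sup [IsFiniteMeasure P] (S : Set (L0bar P)) : IsLUB S (sup S) :=
  (exists_isLUB_L0bar S).choose_spec

/-- A measurable set `S` is an essential supremum of the family `H` of sets: the smallest
measurable set, modulo null sets, that contains every member of `H` modulo null sets. -/
def IsEssSup (P : Measure Ω) (H : Set (Set Ω)) (S : Set Ω) : Prop :=
  MeasurableSet S ∧ (∀ A ∈ H, A ≤ᵐ[P] S) ∧
    ∀ B, MeasurableSet B → (∀ A ∈ H, A ≤ᵐ[P] B) → S ≤ᵐ[P] B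

/-- The indicator of `A` as an element of `L̄⁰(𝓕)`. -/
def indBar (P : Measure Ω) {A : Set Ω} (hA : MeasurableSet A) : L0bar P :=
  AEEqFun.mk (A.indicator fun _ => (1 : EReal))
    ((stronglyMeasurable_const.indicator hA).aestronglyMeasurable)

theorem exists_isEssSup [IsFiniteMeasure P] (H : Set (Set Ω)) (hH : ∀ A ∈ H, MeasurableSet A) :
    ∃ S, IsEssSup P H S := by
  let T : Set (L0bar P) := {η | ∃ A ∈ H, ∃ hA : MeasurableSet A, η = indBar P hA}
  refine ⟨{ω | 0 < sup T ω},
    measurableSet_lt measurable_const (sup T).stronglyMeasurable.measurable, ?_, ?_⟩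
  · intro A hAH
    have h := AEEqFun.coeFn_le.2 ((isLUB_sup T).1 ⟨A, hAH, hH A hAH, rfl⟩)
    filter_upwards [h, AEEqFun.coeFn_mk (μ := P) (A.indicator fun _ => (1 : EReal))
      ((stronglyMeasurable_const.indicator (hH A hAH)).aestronglyMeasurable)] with ω h1 h2
    intro hω
    have hω' : ω ∈ A := hω
    have h3 : indBar P (hH A hAH) ω = 1 := by
      rw [indBar, h2, Set.indicator_of_mem hω']
    rw [h3] at h1
    exact zero_lt_one.trans_le h1
  · intro B hB hAB
    have hub : indBar P hB ∈ upperBounds T := by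
      rintro _ ⟨A, hAH, hA, rfl⟩
      rw [← AEEqFun.coeFn_le]
      filter_upwards [hAB A hAH, AEEqFun.coeFn_mk (μ := P) (A.indicator fun _ => (1 : EReal))
        ((stronglyMeasurable_const.indicator hA).aestronglyMeasurable),
        AEEqFun.coeFn_mk (μ := P) (B.indicator fun _ => (1 : EReal))
        ((stronglyMeasurable_const.indicator hB).aestronglyMeasurable)] with ω h1 h2 h3
      rw [indBar, indBar, h2, h3]
      by_cases hω : ω ∈ A
      · rw [Set.indicator_of_mem hω, Set.indicator_of_mem (h1 hω)]
      · rw [Set.indicator_of_notMem hω]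
        exact Set.indicator_nonneg (fun _ _ => zero_le_one) ω
    have h := AEEqFun.coeFn_le.2 ((isLUB_sup T).2 hub)
    filter_upwards [h, AEEqFun.coeFn_mk (μ := P) (B.indicator fun _ => (1 : EReal))
      ((stronglyMeasurable_const.indicator hB).aestronglyMeasurable)] with ω h1 h2
    intro hω
    have hω' : 0 < sup T ω := hω
    by_contra hB'
    have h3 : indBar P hB ω = 0 := by
      rw [indBar, h2, Set.indicator_of_notMem (fun h => hB' h)]
    rw [h3] at h1
    exact absurd hω' (not_lt.2 h1)

/-- `esssup(H)` for a family `H` of measurable sets. -/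
def essSupSet [IsFiniteMeasure P] (H : Set (Set Ω)) (hH : ∀ A ∈ H, MeasurableSet A) : Set Ω :=
  (exists_isEssSup (P := P) H hH).choose

theorem isEssSup_essSupSet [IsFiniteMeasure P] (H : Set (Set Ω))
    (hH : ∀ A ∈ H, MeasurableSet A) : IsEssSup P H (essSupSet (P := P) H hH) :=
  (exists_isEssSup (P := P) H hH).choose_spec

end Base

section Modules

variable {Ω : Type*} [MeasurableSpace Ω] {P : Measure Ω} {E : Type*} [AddCommGroup E]
  [Module (L0 P) E]

/-- `p : E → L⁰₊(𝓕)` is an `L⁰`-seminorm on the `L⁰(𝓕)`-module `E`. -/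
structure IsL0Seminorm (p : E → L0 P) : Prop where
  nonneg : ∀ x, 0 ≤ p x
  smul : ∀ (ξ : L0 P) (x : E), p (ξ • x) = |ξ| * p x
  add_le : ∀ x y : E, p (x + y) ≤ p x + p y

/-- `(E, 𝒮)` is a random locally convex module over `ℝ`: `𝒮` is a separating family of
`L⁰`-seminorms on the `L⁰(𝓕)`-module `E`. -/
structure IsRLCModule (𝒮 : Set (E → L0 P)) : Prop where
  seminorm : ∀ p ∈ 𝒮, IsL0Seminorm p
  separating : ∀ x : E, (∀ p ∈ 𝒮, p x = 0) ↔ x = 0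

/-- `N_θ(Q, ε, λ) = {x | P(‖x‖_Q < ε) > 1 - λ}`, where `‖x‖_Q` is the maximum of the `p x`,
`p ∈ Q`. -/
def epsLamNhd (Q : Finset (E → L0 P)) (ε l : ℝ) : Set E :=
  {x | 1 - l < (P {ω | ∀ p ∈ Q, p x ω < ε}).toReal}

/-- The `(ε, λ)`-topology induced by `𝒮`, with the sets `N_θ(Q, ε, λ)`, `Q ⊆ 𝒮` finite, as
a local base at the origin: a set is open iff with each point `x` it contains some
`x + N_θ(Q, ε, λ)`. -/
@[reducible]
def epsLamTopology [IsFiniteMeasure P] (𝒮 : Set (E → L0 P)) : TopologicalSpace E where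
  IsOpen U := ∀ x ∈ U, ∃ Q : Finset (E → L0 P), (Q : Set (E → L0 P)) ⊆ 𝒮 ∧
    ∃ ε l : ℝ, 0 < ε ∧ 0 < l ∧ l < 1 ∧ ∀ y ∈ epsLamNhd Q ε l, x + y ∈ U
  isOpen_univ := fun _ _ =>
    ⟨∅, by simp, 1, 1 / 2, one_pos, by norm_num, by norm_num, fun _ _ => trivial⟩
  isOpen_inter := by
    classical
    rintro U V hU hV x ⟨hxU, hxV⟩
    obtain ⟨Q, hQ, ε, l, hε, hl, hl1, h⟩ := hU x hxU
    obtain ⟨Q', hQ', ε', l', hε', hl', hl1', h'⟩ := hV x hxV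
    refine ⟨Q ∪ Q', by simp [hQ, hQ'], min ε ε', min l l', lt_min hε hε', lt_min hl hl',
      (min_le_left _ _).trans_lt hl1, fun y hy => ⟨h y ?_, h' y ?_⟩⟩
    · refine (sub_le_sub_left (min_le_left l l') 1).trans_lt (lt_of_lt_of_le hy ?_)
      exact ENNReal.toReal_mono (measure_ne_top _ _) (measure_mono fun ω hω p hp =>
        (hω p (Finset.mem_union_left _ hp)).trans_le (min_le_left _ _))
    · refine (sub_le_sub_left (min_le_right l l') 1).trans_lt (lt_of_lt_of_le hy ?_)
      exact ENNReal.toReal_mono (measure_ne_top _ _) (measure_mono fun ω hω p hp =>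
        (hω p (Finset.mem_union_right _ hp)).trans_le (min_le_right _ _))
  isOpen_sUnion := by
    rintro 𝒰 h𝒰 x ⟨U, hU, hxU⟩
    obtain ⟨Q, hQ, ε, l, hε, hl, hl1, h⟩ := h𝒰 U hU x hxU
    exact ⟨Q, hQ, ε, l, hε, hl, hl1, fun y hy => ⟨U, hU, h y hy⟩⟩

/-- The `(ε, λ)`-topology of `L⁰(𝓕)`, induced by the single `L⁰`-norm `|·|`. -/
@[reducible]
def epsLamTopologyL0 (P : Measure Ω) [IsFiniteMeasure P] : TopologicalSpace (L0 P) :=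
  epsLamTopology (P := P) {fun ξ : L0 P => |ξ|}

/-- The random conjugate space `E*_{ε,λ}`: the module homomorphisms `E → L⁰(𝓕)` that are
continuous for the `(ε, λ)`-topologies. -/
def randomConjugate [IsFiniteMeasure P] (𝒮 : Set (E → L0 P)) : Set (E →ₗ[L0 P] L0 P) :=
  {g | @Continuous E (L0 P) (epsLamTopology 𝒮) (epsLamTopologyL0 P) g}

/-- `f : E → L̄⁰(𝓕)` is local: `Ĩ_A f(x) = Ĩ_A f(Ĩ_A x)`, that is, `f(x) = f(Ĩ_A x)` almost
surely on `A`. -/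
def IsLocal (f : E → L0bar P) : Prop :=
  ∀ (x : E) (A : Set Ω) (hA : MeasurableSet A), ∀ᵐ ω ∂P, ω ∈ A → f x ω = f (ind P hA • x) ω

/-- The conjugate `f*(g) = ⋁ {g(x) - f(x) | x ∈ E}`. -/
def conj [IsFiniteMeasure P] (f : E → L0bar P) (g : E →ₗ[L0 P] L0 P) : L0bar P :=
  sup (Set.range fun x : E => realSub (g x) (f x))

/-- The biconjugate `f**_{ε,λ}(x) = ⋁ {g(x) - f*(g) | g ∈ E*_{ε,λ}}`. -/
def biconj [IsFiniteMeasure P] (𝒮 : Set (E → L0 P)) (f : E → L0bar P) (x : E) : L0bar P :=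
  sup ((fun g : E →ₗ[L0 P] L0 P => realSub (g x) (conj f g)) '' randomConjugate 𝒮)

/-- `MI(f)`: the essential supremum of the sets `A` such that `f(x) = -∞` on `A` for some `x`. -/
def MI [IsFiniteMeasure P] (f : E → L0bar P) : Set Ω :=
  essSupSet (P := P) {A | MeasurableSet A ∧ ∃ x, ∀ᵐ ω ∂P, ω ∈ A → f x ω = ⊥} fun _ h => h.1

/-- `PI(f)`: the essential supremum of the sets `A` such that `f(x) = +∞` on `A` for all `x`. -/
def PI [IsFiniteMeasure P] (f : E → L0bar P) : Set Ω :=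
  essSupSet (P := P) {A | MeasurableSet A ∧ ∀ x, ∀ᵐ ω ∂P, ω ∈ A → f x ω = ⊤} fun _ h => h.1

/-- `BP(f) = Ω \ (MI(f) ∪ PI(f))`. -/
def BP [IsFiniteMeasure P] (f : E → L0bar P) : Set Ω := (MI f ∪ PI f)ᶜ

/-- `E^A = Ĩ_A E`. -/
def part (P : Measure Ω) (E : Type*) [AddCommGroup E] [Module (L0 P) E] {A : Set Ω} (hA : MeasurableSet A) :
    Set E :=
  Set.range fun x : E => ind P hA • x

/-!
For measurable `A`, the function `f_A : E^A → Ĩ_A L̄⁰(𝓕)` is the restriction of `Ĩ_A f` to `E^A`,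
and `E^A` is viewed over the base `(A, A ∩ 𝓕, P(· | A))`. Thus relations between values of `f_A`
are relations between values of `f` that hold almost surely on `A`.
-/

/-- `f_A` is proper: `f_A(x) < +∞` on `A` for some `x ∈ E^A`, and `f_A(x) > -∞` on `A` for
all `x ∈ E^A`. -/
def IsProperOn {A : Set Ω} (hA : MeasurableSet A) (f : E → L0bar P) : Prop :=
  (∃ x ∈ part P E hA, ∀ᵐ ω ∂P, ω ∈ A → f x ω < ⊤) ∧
    ∀ x ∈ part P E hA, ∀ᵐ ω ∂P, ω ∈ A → ⊥ < f x ω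

/-- `f_A` is `L⁰(A ∩ 𝓕)`-convex. In `EReal`, `0 * (±∞) = 0`; this is only used for proper `f_A`,
where the sum on the right never has the form `∞ - ∞`. -/
def IsConvexOn {A : Set Ω} (hA : MeasurableSet A) (f : E → L0bar P) : Prop :=
  ∀ x ∈ part P E hA, ∀ y ∈ part P E hA, ∀ ξ : L0 P, 0 ≤ ξ → ξ ≤ 1 →
    ∀ᵐ ω ∂P, ω ∈ A →
      f (ξ • x + (1 - ξ) • y) ω
        ≤ ((ξ ω : ℝ) : EReal) * f x ω + ((1 - ξ ω : ℝ) : EReal) * f y ω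

/-- The epigraph of `f_A`, a subset of `E^A × Ĩ_A L⁰(𝓕)`. -/
def epiOn {A : Set Ω} (hA : MeasurableSet A) (f : E → L0bar P) : Set (E × L0 P) :=
  {z | z.1 ∈ part P E hA ∧ z.2 ∈ part P (L0 P) hA ∧
    ∀ᵐ ω ∂P, ω ∈ A → f z.1 ω ≤ ((z.2 ω : ℝ) : EReal)}

/-- `f_A` is `𝒯_{ε,λ}`-lower semicontinuous: its epigraph is closed in `E^A × Ĩ_A L⁰(𝓕)`, a
subspace of `E × L⁰(𝓕)` with the product of the `(ε, λ)`-topologies. -/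
def IsLscOn [IsFiniteMeasure P] (𝒮 : Set (E → L0 P)) {A : Set Ω} (hA : MeasurableSet A)
    (f : E → L0bar P) : Prop :=
  ∃ C : Set (E × L0 P),
    @IsClosed (E × L0 P)
      (@instTopologicalSpaceProd E (L0 P) (epsLamTopology 𝒮) (epsLamTopologyL0 P)) C ∧
    epiOn hA f = C ∩ (part P E hA ×ˢ part P (L0 P) hA)

/-- `f` is a `𝒯_{ε,λ}`-closed function: `f` is local, `f = -∞` on `MI(f)`, and `f_A` is
`L⁰(A ∩ 𝓕)`-convex and `𝒯_{ε,λ}`-lower semicontinuous for each measurable `A ⊆ BP(f)` of positive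
probability for which `f_A` is proper. -/
structure IsClosedFunction [IsFiniteMeasure P] (𝒮 : Set (E → L0 P)) (f : E → L0bar P) : Prop where
  isLocal : IsLocal f
  eq_bot : ∀ x, ∀ᵐ ω ∂P, ω ∈ MI f → f x ω = ⊥
  convex_lsc : ∀ (A : Set Ω) (hA : MeasurableSet A), A ⊆ BP f → 0 < P A → IsProperOn hA f →
    IsConvexOn hA f ∧ IsLscOn 𝒮 hA f

/-- `h` is the `𝒯_{ε,λ}`-closure `Cl_{ε,λ}(f)` of `f`: the greatest `𝒯_{ε,λ}`-closed function
majorized by `f`, for the pointwise order of functions `E → L̄⁰(𝓕)`. -/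
def IsEpsLamClosure [IsFiniteMeasure P] (𝒮 : Set (E → L0 P)) (f h : E → L0bar P) : Prop :=
  IsGreatest {k : E → L0bar P | IsClosedFunction 𝒮 k ∧ k ≤ f} h

end Modules

end RLC

end

/-! The biconjugate is a supremum of functions `g - f*(g)` with `g` continuous and linear. Locality,
convexity, closedness of epigraphs and the spreading of the value `-∞` all pass to such a supremum
(`isClosedFunction_biconj`), and it lies below `f` by the Fenchel–Young inequality (`biconj_le`).
What remains is that it dominates every closed `k ≤ f` (`IsClosedFunction.le_biconj`).

If it does not, there are a rational `q` and a set `B ⊆ BP(k)` of positive probability with `f**(x)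
< q < k(x)` on `B`; after shrinking `B`, some `k(y₁)` is finite on it. The point `(x, q)` is then
separated from the epigraph of `k_B` in `E × L⁰`, on a smaller set `D` of positive probability.
Where the separating hyperplane is not vertical, division by its slope gives an affine minorant of
`k` on `D` whose value at `x` is at least `q`. If it is vertical almost everywhere on `D`, a large
random multiple of it is added to a minorant obtained by separating `(y₁, k(y₁) - 1)`. An affine
minorant of `k` on `D` is a minorant of `f`, hence of `f**`, on `D` (`affine_le_biconj`), a
contradiction (`IsClosedFunction.false_of_biconj_lt`).

The separation needs two tools. Convexity over `L⁰` permits splicing along measurable sets, so an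
exhaustion argument turns "far from the origin in probability" into "at distance at least `ε`
everywhere on one set `D`, for all points of the convex set at once"
(`IsSublinear.exists_forall_le_on`). A Mazur–Orlicz theorem over `L⁰`, proved through minimal
sublinear maps, then gives the functional (`IsSublinear.exists_linear_le`). -/

noncomputable section

namespace RLC

/-! ### Pointwise calculus, order and infima in `L⁰` and `L̄⁰`. -/

section Base

variable {Ω : Type*} [MeasurableSpace Ω] {P : Measure Ω}

theorem L0.le_iff {a b : L0 P} : a ≤ b ↔ ∀ᵐ ω ∂P, a ω ≤ b ω := AEEqFun.coeFn_le.symm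

theorem L0.measurable (a : L0 P) : Measurable a := a.stronglyMeasurable.measurable

theorem L0bar.measurable (a : L0bar P) : Measurable a := a.stronglyMeasurable.measurable

theorem L0.zero_ae : ∀ᵐ ω ∂P, (0 : L0 P) ω = 0 := AEEqFun.coeFn_zero

theorem L0.one_ae : ∀ᵐ ω ∂P, (1 : L0 P) ω = 1 := AEEqFun.coeFn_one

theorem L0.add_ae (a b : L0 P) : ∀ᵐ ω ∂P, (a + b) ω = a ω + b ω := AEEqFun.coeFn_add a b

theorem L0.sub_ae (a b : L0 P) : ∀ᵐ ω ∂P, (a - b) ω = a ω - b ω := AEEqFun.coeFn_sub a b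

theorem L0.mul_ae (a b : L0 P) : ∀ᵐ ω ∂P, (a * b) ω = a ω * b ω := AEEqFun.coeFn_mul a b

theorem L0.neg_ae (a : L0 P) : ∀ᵐ ω ∂P, (-a) ω = -a ω := AEEqFun.coeFn_neg a

theorem L0.abs_ae (a : L0 P) : ∀ᵐ ω ∂P, |a| ω = |a ω| := AEEqFun.coeFn_abs a

instance L0.instIsOrderedAddMonoid : IsOrderedAddMonoid (L0 P) where
  add_le_add_left a b h c := by
    rw [L0.le_iff] at h ⊢
    filter_upwards [h, L0.add_ae a c, L0.add_ae b c] with ω h h1 h2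
    rw [h1, h2]
    gcongr

instance L0.instZeroLEOneClass : ZeroLEOneClass (L0 P) where
  zero_le_one := by
    rw [L0.le_iff]
    filter_upwards [L0.zero_ae (P := P), L0.one_ae (P := P)] with ω h1 h2
    rw [h1, h2]
    exact zero_le_one

theorem L0.mul_nonneg' {a b : L0 P} (ha : 0 ≤ a) (hb : 0 ≤ b) : 0 ≤ a * b := by
  rw [L0.le_iff] at *
  filter_upwards [ha, hb, L0.zero_ae (P := P), L0.mul_ae a b] with ω h1 h2 h3 h4
  rw [h3] at h1 h2 ⊢
  rw [h4]
  exact mul_nonneg h1 h2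

instance L0.instIsOrderedRing : IsOrderedRing (L0 P) :=
  IsOrderedRing.of_mul_nonneg fun _ _ ha hb => L0.mul_nonneg' ha hb

/-- The constant random variable with value `r`. -/
def L0.const (P : Measure Ω) (r : ℝ) : L0 P := AEEqFun.const Ω r

theorem L0.const_ae (r : ℝ) : ∀ᵐ ω ∂P, L0.const P r ω = r := AEEqFun.coeFn_const Ω r

/-- The pointwise inverse, with the convention `0⁻¹ = 0`. -/
def L0.inv (a : L0 P) : L0 P := AEEqFun.compMeasurable (fun r : ℝ => r⁻¹) measurable_inv a

theorem L0.inv_ae (a : L0 P) : ∀ᵐ ω ∂P, L0.inv a ω = (a ω)⁻¹ :=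
  AEEqFun.coeFn_compMeasurable _ _ a

/-- The class of the real part of an extended real random variable. -/
def L0bar.toReal (η : L0bar P) : L0 P :=
  AEEqFun.compMeasurable EReal.toReal measurable_ereal_toReal η

theorem L0bar.toReal_ae (η : L0bar P) : ∀ᵐ ω ∂P, η.toReal ω = (η ω).toReal :=
  AEEqFun.coeFn_compMeasurable _ _ η

/-- The inclusion of `L⁰` in `L̄⁰`. -/
def L0.toBar (a : L0 P) : L0bar P :=
  AEEqFun.compMeasurable (fun r : ℝ => (r : EReal)) measurable_coe_real_ereal a

theorem L0.toBar_ae (a : L0 P) : ∀ᵐ ω ∂P, a.toBar ω = (a ω : EReal) :=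
  AEEqFun.coeFn_compMeasurable _ _ a

theorem realSub_ae (ξ : L0 P) (η : L0bar P) : ∀ᵐ ω ∂P, realSub ξ η ω = (ξ ω : EReal) - η ω :=
  AEEqFun.coeFn_comp₂Measurable _ _ ξ η

theorem ind_ae {A : Set Ω} (hA : MeasurableSet A) :
    ∀ᵐ ω ∂P, ind P hA ω = A.indicator (fun _ => (1 : ℝ)) ω := AEEqFun.coeFn_mk _ _

theorem ind_ae_mem {A : Set Ω} (hA : MeasurableSet A) : ∀ᵐ ω ∂P, ω ∈ A → ind P hA ω = 1 := by
  filter_upwards [ind_ae (P := P) hA] with ω h hω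
  rw [h, Set.indicator_of_mem hω]

theorem ind_ae_notMem {A : Set Ω} (hA : MeasurableSet A) : ∀ᵐ ω ∂P, ω ∉ A → ind P hA ω = 0 := by
  filter_upwards [ind_ae (P := P) hA] with ω h hω
  rw [h, Set.indicator_of_notMem hω]

theorem ind_nonneg {A : Set Ω} (hA : MeasurableSet A) : 0 ≤ ind P hA := by
  rw [L0.le_iff]
  filter_upwards [ind_ae (P := P) hA, L0.zero_ae (P := P)] with ω h h0
  rw [h, h0]
  exact Set.indicator_nonneg (fun _ _ => zero_le_one) ω

theorem ind_le_one {A : Set Ω} (hA : MeasurableSet A) : ind P hA ≤ 1 := by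
  rw [L0.le_iff]
  filter_upwards [ind_ae (P := P) hA, L0.one_ae (P := P)] with ω h h0
  rw [h, h0]
  exact Set.indicator_le_self' (fun _ _ => zero_le_one) ω

theorem ind_mul_ind {A : Set Ω} (hA : MeasurableSet A) : ind P hA * ind P hA = ind P hA := by
  apply AEEqFun.ext
  filter_upwards [ind_ae (P := P) hA, L0.mul_ae (ind P hA) (ind P hA)] with ω h h0
  rw [h0, h]
  by_cases hω : ω ∈ A <;> simp [hω]

/-- `L⁰` is conditionally complete. -/
theorem L0.exists_isGLB [IsFiniteMeasure P] {S : Set (L0 P)} (hS : S.Nonempty)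
    (hb : BddBelow S) : ∃ i, IsGLB S i := by
  obtain ⟨b, hb⟩ := hb
  obtain ⟨a₀, ha₀⟩ := hS
  let T : Set (L0bar P) := (fun a : L0 P => (-a).toBar) '' S
  have hneg : ∀ a : L0 P, ∀ᵐ ω ∂P, (-a).toBar ω = -(a ω : EReal) := fun a => by
    filter_upwards [(-a).toBar_ae, L0.neg_ae a] with ω h1 h2
    rw [h1, h2, EReal.coe_neg]
  have hlb : ∀ c ∈ lowerBounds S, ∀ᵐ ω ∂P, sup T ω ≤ -(c ω : EReal) := fun c hc => by
    have h : sup T ≤ (-c).toBar := (isLUB_sup T).2 (by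
      rintro _ ⟨a, ha, rfl⟩
      rw [← AEEqFun.coeFn_le]
      filter_upwards [hneg a, hneg c, L0.le_iff.1 (hc ha)] with ω h1 h2 h3
      rw [h1, h2, EReal.neg_le_neg_iff]
      exact_mod_cast h3)
    filter_upwards [AEEqFun.coeFn_le.2 h, hneg c] with ω h1 h2
    rwa [← h2]
  have hub : ∀ a ∈ S, ∀ᵐ ω ∂P, -(a ω : EReal) ≤ sup T ω := fun a ha => by
    filter_upwards [AEEqFun.coeFn_le.2 ((isLUB_sup T).1 ⟨a, ha, rfl⟩), hneg a] with ω h1 h2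
    rwa [← h2]
  have hreal : ∀ᵐ ω ∂P, ((-(sup T).toReal : L0 P) ω : EReal) = -(sup T ω) := by
    filter_upwards [hlb b hb, hub a₀ ha₀, L0.neg_ae (sup T).toReal, (sup T).toReal_ae]
      with ω h1 h2 h3 h4
    have h5 : sup T ω ≠ ⊤ := by
      intro h; rw [h] at h1; simp at h1
    have h6 : sup T ω ≠ ⊥ := by
      intro h; rw [h] at h2; simp at h2
    rw [h3, h4, EReal.coe_neg, EReal.coe_toReal h5 h6]
  refine ⟨-(sup T).toReal, fun a ha => L0.le_iff.2 ?_, fun c hc => L0.le_iff.2 ?_⟩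
  · filter_upwards [hub a ha, hreal] with ω h1 h2
    rw [← EReal.coe_le_coe_iff, h2]
    exact EReal.neg_le_of_neg_le h1
  · filter_upwards [hlb c hc, hreal] with ω h1 h2
    rw [← EReal.coe_le_coe_iff, h2]
    exact EReal.le_neg_of_le_neg h1

/-- Since `l` may vanish with positive probability, the bound cannot simply be divided by `l`: where
`l = 0` the hypothesis reads `c ≤ 0`, elsewhere division works. This makes pointwise infima of
sublinear maps positively homogeneous. -/
theorem L0.le_mul_of_isGLB {S : Set (L0 P)} {i c l : L0 P} (hS : S.Nonempty) (hi : IsGLB S i)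
    (hl : 0 ≤ l) (h : ∀ a ∈ S, c ≤ l * a) : c ≤ l * i := by
  obtain ⟨a₀, ha₀⟩ := hS
  -- a lower bound of `S` that equals `c / l` where `0 < l`
  have hlow : L0.inv l * c + (1 - L0.inv l * l) * i ∈ lowerBounds S := by
    intro a ha
    rw [L0.le_iff] at hl ⊢
    filter_upwards [hl, L0.le_iff.1 (h a ha), L0.le_iff.1 (hi.1 ha), L0.zero_ae (P := P),
      L0.one_ae (P := P), L0.mul_ae l a, L0.inv_ae l, L0.mul_ae (L0.inv l) c,
      L0.mul_ae (1 - L0.inv l * l) i, L0.sub_ae 1 (L0.inv l * l), L0.mul_ae (L0.inv l) l,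
      L0.add_ae (L0.inv l * c) ((1 - L0.inv l * l) * i)]
      with ω hl h h' h1 h2 h3 h4 h5 h6 h7 h8 h9
    rw [h9, h5, h6, h7, h8, h4, h2]
    rw [h1] at hl
    rw [h3] at h
    rcases hl.eq_or_lt with h0 | h0
    · simp [← h0, h']
    · rw [inv_mul_cancel₀ h0.ne', sub_self, zero_mul, add_zero, inv_mul_le_iff₀ h0]
      exact h
  have hle := hi.2 hlow
  rw [L0.le_iff] at hl hle ⊢
  filter_upwards [hl, hle, L0.le_iff.1 (h a₀ ha₀), L0.zero_ae (P := P),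
      L0.one_ae (P := P), L0.mul_ae l a₀, L0.inv_ae l, L0.mul_ae (L0.inv l) c,
      L0.mul_ae (1 - L0.inv l * l) i, L0.sub_ae 1 (L0.inv l * l), L0.mul_ae (L0.inv l) l,
      L0.add_ae (L0.inv l * c) ((1 - L0.inv l * l) * i), L0.mul_ae l i]
      with ω hl h h' h1 h2 h3 h4 h5 h6 h7 h8 h9 h10
  rw [h9, h5, h6, h7, h8, h4, h2] at h
  rw [h1] at hl
  rw [h3] at h'
  rw [h10]
  rcases hl.eq_or_lt with h0 | h0
  · simpa [← h0] using h'
  · rwa [inv_mul_cancel₀ h0.ne', sub_self, zero_mul, add_zero, inv_mul_le_iff₀ h0] at h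

/-- A bound for the members of `S` on a measurable set bounds `⋁ S` there. -/
theorem sup_le_on [IsFiniteMeasure P] {S : Set (L0bar P)} {A : Set Ω} (hA : MeasurableSet A)
    {η : L0bar P} (h : ∀ s ∈ S, ∀ᵐ ω ∂P, ω ∈ A → s ω ≤ η ω) :
    ∀ᵐ ω ∂P, ω ∈ A → sup S ω ≤ η ω := by
  classical
  -- Setting the bound to `⊤` off `A` makes it an upper bound in the whole lattice.
  have hm : AEStronglyMeasurable (A.piecewise η fun _ => (⊤ : EReal)) P :=
    (Measurable.piecewise hA (L0bar.measurable η) measurable_const).aestronglyMeasurable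
  have hle : sup S ≤ AEEqFun.mk _ hm := (isLUB_sup S).2 fun s hs => by
    rw [← AEEqFun.coeFn_le]
    filter_upwards [h s hs, AEEqFun.coeFn_mk _ hm] with ω h1 h2
    rw [h2]
    by_cases hω : ω ∈ A
    · rw [Set.piecewise_eq_of_mem _ _ _ hω]; exact h1 hω
    · rw [Set.piecewise_eq_of_notMem _ _ _ hω]; exact le_top
  filter_upwards [AEEqFun.coeFn_le.2 hle, AEEqFun.coeFn_mk _ hm] with ω h1 h2 hω
  rwa [h2, Set.piecewise_eq_of_mem _ _ _ hω] at h1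

theorem le_sup [IsFiniteMeasure P] {S : Set (L0bar P)} {s : L0bar P} (hs : s ∈ S) :
    ∀ᵐ ω ∂P, s ω ≤ sup S ω :=
  AEEqFun.coeFn_le.2 ((isLUB_sup S).1 hs)

end Base

/-! ### The Hahn–Banach theorem over `L⁰`. -/

section HahnBanach

variable {Ω : Type*} [MeasurableSpace Ω] {P : Measure Ω} {M : Type*} [AddCommGroup M]
  [Module (L0 P) M]

theorem L0.inv_nonneg {a : L0 P} (ha : 0 ≤ a) : 0 ≤ L0.inv a := by
  rw [L0.le_iff] at *
  filter_upwards [ha, L0.inv_ae a, L0.zero_ae (P := P)] with ω h1 h2 h3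
  rw [h3] at h1 ⊢
  rw [h2]
  exact _root_.inv_nonneg.2 h1

theorem L0.inv_mul_le_one (a : L0 P) : L0.inv a * a ≤ 1 := by
  rw [L0.le_iff]
  filter_upwards [L0.inv_ae a, L0.mul_ae (L0.inv a) a, L0.one_ae (P := P)] with ω h1 h2 h3
  rw [h2, h1, h3]
  exact _root_.inv_mul_le_one

theorem L0.inv_mul_mul_self (a : L0 P) : L0.inv a * a * a = a := by
  apply AEEqFun.ext
  filter_upwards [L0.inv_ae a, L0.mul_ae (L0.inv a) a, L0.mul_ae (L0.inv a * a) a] with ω h1 h2 h3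
  rw [h3, h2, h1]
  by_cases h : a ω = 0
  · simp [h]
  · rw [inv_mul_cancel₀ h, one_mul]

/-- An `L⁰`-sublinear map `q : M → L⁰`. -/
structure IsSublinear (q : M → L0 P) : Prop where
  add_le : ∀ x y, q (x + y) ≤ q x + q y
  smul_le : ∀ (ξ : L0 P) (x : M), 0 ≤ ξ → q (ξ • x) ≤ ξ * q x

/-- `L⁰`-convex subsets of an `L⁰`-module. -/
def IsL0Convex (K : Set M) : Prop :=
  ∀ v ∈ K, ∀ w ∈ K, ∀ ξ : L0 P, 0 ≤ ξ → ξ ≤ 1 → ξ • v + (1 - ξ) • w ∈ K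

namespace IsSublinear

variable {q : M → L0 P}

theorem zero_le (hq : IsSublinear q) : 0 ≤ q 0 := by
  have h := hq.add_le 0 0
  rw [add_zero] at h
  exact nonneg_of_le_add_right h

theorem map_zero (hq : IsSublinear q) : q 0 = 0 :=
  le_antisymm (by simpa using hq.smul_le 0 0 le_rfl) hq.zero_le

theorem neg_le (hq : IsSublinear q) (x : M) : -q (-x) ≤ q x := by
  have h := hq.add_le x (-x)
  rw [add_neg_cancel, hq.map_zero] at h
  exact neg_le_iff_add_nonneg.2 h

/-- The element `e = L0.inv ξ * ξ` is the indicator of `{ξ ≠ 0}`. Where `e = 1`, the inequality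
applied to the inverse of `ξ` gives the missing bound. Since `e * ξ = ξ`, both `q (ξ • x)` and `q
(-(ξ • x))` are at most `0` where `e = 0`, and subadditivity forces `q (ξ • x)` to vanish there. -/
theorem map_smul (hq : IsSublinear q) {ξ : L0 P} (hξ : 0 ≤ ξ) (x : M) : q (ξ • x) = ξ * q x := by
  refine le_antisymm (hq.smul_le ξ x hξ) ?_
  have he0 : 0 ≤ L0.inv ξ * ξ := mul_nonneg (L0.inv_nonneg hξ) hξ
  have he1 : 0 ≤ 1 - L0.inv ξ * ξ := sub_nonneg.2 (L0.inv_mul_le_one ξ)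
  have heξ : L0.inv ξ * ξ * ξ = ξ := L0.inv_mul_mul_self ξ
  have h1 : q x ≤ L0.inv ξ * q (ξ • x) + (1 - L0.inv ξ * ξ) * q x := by
    calc q x = q (L0.inv ξ • ξ • x + (1 - L0.inv ξ * ξ) • x) := by
          rw [smul_smul, sub_smul, one_smul, add_sub_cancel]
      _ ≤ _ := (hq.add_le _ _).trans
          (add_le_add (hq.smul_le _ _ (L0.inv_nonneg hξ)) (hq.smul_le _ _ he1))
  have h2 : ∀ y : M, (1 - L0.inv ξ * ξ) * q (ξ • y) ≤ 0 := fun y => by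
    have h := hq.smul_le (L0.inv ξ * ξ) (ξ • y) he0
    rw [smul_smul, heξ] at h
    rw [sub_mul, one_mul, sub_nonpos]
    exact h
  have h3 : 0 ≤ (1 - L0.inv ξ * ξ) * q (ξ • x) := by
    have h4 := mul_le_mul_of_nonneg_left (hq.neg_le (ξ • x)) he1
    refine le_trans ?_ h4
    rw [mul_neg, ← smul_neg]
    exact neg_nonneg.2 (h2 (-x))
  calc ξ * q x ≤ ξ * (L0.inv ξ * q (ξ • x) + (1 - L0.inv ξ * ξ) * q x) :=
        mul_le_mul_of_nonneg_left h1 hξ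
    _ = L0.inv ξ * ξ * q (ξ • x) + (ξ - L0.inv ξ * ξ * ξ) * q x := by ring
    _ = q (ξ • x) - (1 - L0.inv ξ * ξ) * q (ξ • x) := by rw [heξ]; ring
    _ ≤ q (ξ • x) := sub_le_self _ h3

/-- The map is `s h = inf (q (h + t • v) - t * d)` over `t ≥ 0` and `v ∈ K`. The infimum is finite
because `t * d ≤ q (t • v) ≤ q (h + t • v) + q (-h)`; `t = 0` gives `s ≤ q`, and `t = 1` at `h = -v`
gives the last bound. -/
theorem exists_le_of_convex [IsFiniteMeasure P] (hq : IsSublinear q) {K : Set M}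
    (hK : IsL0Convex (P := P) K) (hne : K.Nonempty) {d : L0 P} (hd : ∀ v ∈ K, d ≤ q v) :
    ∃ s : M → L0 P, IsSublinear s ∧ s ≤ q ∧ ∀ v ∈ K, s (-v) ≤ -d := by
  obtain ⟨v₀, hv₀⟩ := hne
  let S : M → Set (L0 P) := fun h => {a | ∃ t : L0 P, 0 ≤ t ∧ ∃ v ∈ K, a = q (h + t • v) - t * d}
  have hSne : ∀ h, (S h).Nonempty := fun h => ⟨_, 0, le_rfl, v₀, hv₀, rfl⟩
  have hSb : ∀ h, BddBelow (S h) := fun h => by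
    refine ⟨-q (-h), ?_⟩
    rintro _ ⟨t, ht, v, hv, rfl⟩
    have h1 : q (t • v) ≤ q (h + t • v) + q (-h) := by
      have := hq.add_le (h + t • v) (-h)
      rwa [add_neg_cancel_comm] at this
    rw [hq.map_smul ht] at h1
    have h2 : t * d ≤ q (h + t • v) + q (-h) := (mul_le_mul_of_nonneg_left (hd v hv) ht).trans h1
    rw [neg_le_iff_add_nonneg, sub_add_eq_add_sub, sub_nonneg]
    exact h2
  choose s hs using fun h => L0.exists_isGLB (hSne h) (hSb h)
  refine ⟨s, ⟨fun x y => ?_, fun ξ x hξ => ?_⟩, fun x => ?_, fun v hv => ?_⟩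
  · have key : ∀ a ∈ S x, ∀ b ∈ S y, s (x + y) ≤ a + b := by
      rintro _ ⟨t, ht, v, hv, rfl⟩ _ ⟨u, hu, w, hw, rfl⟩
      have htu : 0 ≤ t + u := add_nonneg ht hu
      -- The convex weights are `t / (t + u)` and its complement. Where `t + u = 0` the zero
      -- convention is harmless, since nonnegativity forces `t = 0` there.
      have h1 : (t + u) * (L0.inv (t + u) * t) = t := by
        apply AEEqFun.ext
        filter_upwards [L0.mul_ae (t + u) (L0.inv (t + u) * t), L0.mul_ae (L0.inv (t + u)) t,
          L0.inv_ae (t + u), L0.add_ae t u, L0.le_iff.1 ht, L0.le_iff.1 hu, L0.zero_ae (P := P)]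
          with ω e1 e2 e3 e4 e5 e6 e7
        rw [e1, e2, e3, e4]
        rw [e7] at e5 e6
        by_cases h : t ω + u ω = 0
        · rw [h, zero_mul]; linarith
        · rw [mul_inv_cancel_left₀ h]
      have h2 : (t + u) * (1 - L0.inv (t + u) * t) = u := by
        rw [mul_sub, mul_one, h1, add_sub_cancel_left]
      have hle : L0.inv (t + u) * t ≤ 1 :=
        (mul_le_mul_of_nonneg_left (le_add_of_nonneg_right hu) (L0.inv_nonneg htu)).trans
          (L0.inv_mul_le_one _)
      have hmem := hK v hv w hw _ (mul_nonneg (L0.inv_nonneg htu) ht) hle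
      refine ((hs (x + y)).1 ⟨t + u, htu, _, hmem, rfl⟩).trans ?_
      rw [smul_add, smul_smul, smul_smul, h1, h2, add_add_add_comm]
      have := hq.add_le (x + t • v) (y + u • w)
      calc _ ≤ q (x + t • v) + q (y + u • w) - (t + u) * d := sub_le_sub_right this _
        _ = _ := by ring
    have h2 : ∀ b ∈ S y, s (x + y) - b ≤ s x := fun b hb =>
      (hs x).2 fun a ha => sub_le_iff_le_add.2 (key a ha b hb)
    rw [← sub_le_iff_le_add']
    exact (hs y).2 fun b hb => sub_le_comm.1 (h2 b hb)
  · refine L0.le_mul_of_isGLB (hSne x) (hs x) hξ ?_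
    rintro _ ⟨t, ht, v, hv, rfl⟩
    refine ((hs (ξ • x)).1 ⟨ξ * t, mul_nonneg hξ ht, v, hv, rfl⟩).trans (le_of_eq ?_)
    rw [mul_smul, ← smul_add, hq.map_smul hξ]
    ring
  · exact (hs x).1 ⟨0, le_rfl, v₀, hv₀, by simp⟩
  · exact (hs (-v)).1 ⟨1, zero_le_one, v, hv, by simp [hq.map_zero]⟩

/-- Zorn's lemma for the reversed order: the pointwise infimum of a chain is sublinear, and any
member `y` of the chain supplies the lower bound `-y (-x)`. -/
theorem exists_minimal_le [IsFiniteMeasure P] (hq : IsSublinear q) :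
    ∃ m : M → L0 P, m ≤ q ∧ Minimal IsSublinear m := by
  refine @zorn_le_nonempty₀ (M → L0 P)ᵒᵈ _ {s | IsSublinear s} (fun c hc hchain y hy => ?_) q hq
  let S : M → Set (L0 P) := fun x => (fun s : M → L0 P => s x) '' c
  have hSne : ∀ x, (S x).Nonempty := fun x => ⟨_, y, hy, rfl⟩
  have htot : ∀ s t : M → L0 P, s ∈ c → t ∈ c → (∀ x, s x ≤ t x) ∨ ∀ x, t x ≤ s x :=
    fun s t hs ht => (hchain.total hs ht).symm
  have hSb : ∀ x, BddBelow (S x) := fun x => by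
    refine ⟨-(y : M → L0 P) (-x), ?_⟩
    rintro _ ⟨s, hs, rfl⟩
    rcases htot s y hs hy with h | h
    · exact (neg_le_neg (h (-x))).trans ((hc hs).neg_le x)
    · exact ((hc hy).neg_le x).trans (h x)
  choose i hi using fun x => L0.exists_isGLB (hSne x) (hSb x)
  refine ⟨i, ⟨fun x z => ?_, fun ξ x hξ => ?_⟩, fun s hs x => (hi x).1 ⟨s, hs, rfl⟩⟩
  · have key : ∀ a ∈ S x, ∀ b ∈ S z, i (x + z) ≤ a + b := by
      rintro _ ⟨s, hs, rfl⟩ _ ⟨t, ht, rfl⟩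
      rcases htot s t hs ht with h | h
      · exact ((hi _).1 ⟨s, hs, rfl⟩).trans
          (((hc hs).add_le x z).trans (add_le_add le_rfl (h z)))
      · exact ((hi _).1 ⟨t, ht, rfl⟩).trans
          (((hc ht).add_le x z).trans (add_le_add (h x) le_rfl))
    have h2 : ∀ b ∈ S z, i (x + z) - b ≤ i x := fun b hb =>
      (hi x).2 fun a ha => sub_le_iff_le_add.2 (key a ha b hb)
    rw [← sub_le_iff_le_add']
    exact (hi z).2 fun b hb => sub_le_comm.1 (h2 b hb)
  · refine L0.le_mul_of_isGLB (hSne x) (hi x) hξ ?_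
    rintro _ ⟨s, hs, rfl⟩
    exact ((hi _).1 ⟨s, hs, rfl⟩).trans ((hc hs).smul_le ξ x hξ)

end IsSublinear

/-- A minimal sublinear map is linear. -/
theorem exists_linear_of_minimal [IsFiniteMeasure P] {m : M → L0 P} (hm : Minimal IsSublinear m) :
    ∃ g : M →ₗ[L0 P] L0 P, ∀ x, g x = m x := by
  have hs := hm.prop
  have hneg : ∀ y, m (-y) ≤ -m y := fun y => by
    -- With `K = {y}` and `d = m y` the construction yields a sublinear map below `m`. Minimality
    -- makes it equal to `m`, so its bound at `-y` says that `m` is odd.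
    obtain ⟨s, hs1, hs2, hs3⟩ := hs.exists_le_of_convex (K := {y}) (d := m y)
      (by
        rintro _ rfl _ rfl ξ - -
        rw [← add_smul, add_sub_cancel, one_smul]
        rfl) ⟨y, rfl⟩ (by rintro _ rfl; exact le_rfl)
    exact (hm.le_of_le hs1 hs2 (-y)).trans (hs3 y rfl)
  have hadd : ∀ x y, m (x + y) = m x + m y := fun x y => by
    refine le_antisymm (hs.add_le x y) ?_
    have h := (hs.add_le (x + y) (-y)).trans (add_le_add le_rfl (hneg y))
    rw [add_neg_cancel_right, ← sub_eq_add_neg] at h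
    exact le_sub_iff_add_le.1 h
  refine ⟨{ toFun := m, map_add' := hadd, map_smul' := fun ξ x => ?_ }, fun x => rfl⟩
  -- A general scalar is the difference of the nonnegative scalars `ξ + |ξ|` and `|ξ|`.
  have h1 : 0 ≤ ξ + |ξ| := neg_le_iff_add_nonneg'.1 (neg_le_abs ξ)
  have h2 := hadd (ξ • x) (|ξ| • x)
  rw [← add_smul, hs.map_smul h1, hs.map_smul (abs_nonneg ξ), add_mul] at h2
  exact (add_right_cancel h2).symm

/-- The Hahn–Banach theorem for `L⁰`-modules, in the form of Mazur and Orlicz. -/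
theorem IsSublinear.exists_linear_le [IsFiniteMeasure P] {q : M → L0 P} (hq : IsSublinear q)
    {K : Set M} (hK : IsL0Convex (P := P) K) (hne : K.Nonempty) {d : L0 P}
    (hd : ∀ v ∈ K, d ≤ q v) :
    ∃ g : M →ₗ[L0 P] L0 P, (∀ x, g x ≤ q x) ∧ ∀ v ∈ K, d ≤ g v := by
  obtain ⟨s, hs1, hs2, hs3⟩ := hq.exists_le_of_convex hK hne hd
  obtain ⟨m, hm1, hm2⟩ := hs1.exists_minimal_le
  obtain ⟨g, hg⟩ := exists_linear_of_minimal hm2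
  refine ⟨g, fun x => (hg x).le.trans ((hm1 x).trans (hs2 x)), fun v hv => ?_⟩
  have h : g (-v) ≤ -d := (hg (-v)).le.trans ((hm1 (-v)).trans (hs3 v hv))
  rw [map_neg] at h
  exact neg_le_neg_iff.1 h

end HahnBanach

/-! ### From distance in probability to separation on a set of positive probability. -/

section Separation

variable {Ω : Type*} [MeasurableSpace Ω] {P : Measure Ω} {M : Type*} [AddCommGroup M]
  [Module (L0 P) M]

/-- Splice: take `v` where `q v < ε` and `w` elsewhere. The indicator is an admissible convex
weight, so the spliced point stays in `K`. -/
theorem IsSublinear.exists_union_subset {q : M → L0 P} (hq : IsSublinear q) {K : Set M}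
    (hK : IsL0Convex (P := P) K) (ε : ℝ) {v w : M} (hv : v ∈ K) (hw : w ∈ K) :
    ∃ u ∈ K, ({ω | q v ω < ε} ∪ {ω | q w ω < ε} : Set Ω) ≤ᵐ[P] {ω | q u ω < ε} := by
  have hA : MeasurableSet {ω | q v ω < ε} :=
    measurableSet_lt (L0.measurable _) measurable_const
  refine ⟨_, hK v hv w hw (ind P hA) (ind_nonneg hA) (ind_le_one hA), ?_⟩
  have h := (hq.add_le (ind P hA • v) ((1 - ind P hA) • w)).trans
    (add_le_add (hq.smul_le _ v (ind_nonneg hA))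
      (hq.smul_le _ w (sub_nonneg.2 (ind_le_one hA))))
  filter_upwards [L0.le_iff.1 h, L0.add_ae (ind P hA * q v) ((1 - ind P hA) * q w),
    L0.mul_ae (ind P hA) (q v), L0.mul_ae (1 - ind P hA) (q w), L0.sub_ae 1 (ind P hA),
    L0.one_ae (P := P), ind_ae_mem (P := P) hA, ind_ae_notMem (P := P) hA]
    with ω h h1 h2 h3 h4 h5 h6 h7 hω
  rw [h1, h2, h3, h4, h5] at h
  by_cases hvω : ω ∈ {ω | q v ω < ε}
  · rw [h6 hvω] at h
    have hvω' : q v ω < ε := hvω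
    exact lt_of_le_of_lt h (by linarith)
  · rw [h7 hvω] at h
    have hwω : q w ω < ε := Or.resolve_left hω hvω
    exact lt_of_le_of_lt h (by linarith)

/-- By splicing, finite unions of the sets `{q w < ε}` lie in a single such set, so countable unions
have probability at most the supremum, which is at most `1 - l`. The union `T` along a maximizing
sequence attains the supremum, hence absorbs every `{q w < ε}` up to a null set; `D` is its
complement. -/
theorem IsSublinear.exists_forall_le_on [IsProbabilityMeasure P] {q : M → L0 P}
    (hq : IsSublinear q) {K : Set M} (hK : IsL0Convex (P := P) K) (hne : K.Nonempty) {ε l : ℝ}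
    (hl : 0 < l) (h : ∀ w ∈ K, (P {ω | q w ω < ε}).toReal ≤ 1 - l) :
    ∃ D : Set Ω, MeasurableSet D ∧ 0 < P D ∧ ∀ w ∈ K, ∀ᵐ ω ∂P, ω ∈ D → ε ≤ q w ω := by
  have hm : ∀ w, MeasurableSet {ω | q w ω < ε} := fun w =>
    measurableSet_lt (L0.measurable _) measurable_const
  let J : K → ENNReal := fun w => P {ω | q w ω < ε}
  have hKne : Nonempty K := hne.to_subtype
  have hfin : ∀ (u : ℕ → K) (n : ℕ), ∃ v : K,
      (⋃ m ≤ n, {ω | q (u m) ω < ε} : Set Ω) ≤ᵐ[P] {ω | q v ω < ε} := by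
    intro u n
    induction n with
    | zero => exact ⟨u 0, by simpa using Filter.EventuallyLE.rfl⟩
    | succ n ih =>
      obtain ⟨v, hv⟩ := ih
      obtain ⟨w, hw, hw'⟩ := hq.exists_union_subset hK ε v.2 (u (n + 1)).2
      refine ⟨⟨w, hw⟩, ?_⟩
      rw [Set.biUnion_le_succ]
      exact (ae_le_set_union hv Filter.EventuallyLE.rfl).trans hw'
  have hU : ∀ u : ℕ → K, P (⋃ n, {ω | q (u n) ω < ε}) ≤ sSup (Set.range J) := by
    intro u
    rw [measure_iUnion_eq_iSup_accumulate]
    refine iSup_le fun n => ?_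
    obtain ⟨v, hv⟩ := hfin u n
    exact (measure_mono_ae hv).trans (le_sSup ⟨v, rfl⟩)
  obtain ⟨t, -, htlim, htmem⟩ := exists_seq_tendsto_sSup (S := Set.range J)
    (Set.range_nonempty J) (OrderTop.bddAbove _)
  choose u hu using htmem
  let T : Set Ω := ⋃ n, {ω | q (u n) ω < ε}
  have hTm : MeasurableSet T := MeasurableSet.iUnion fun n => hm _
  have hT : P T = sSup (Set.range J) := by
    refine le_antisymm (hU u) (le_of_tendsto' htlim fun n => ?_)
    rw [← hu n]
    exact measure_mono (Set.subset_iUnion (fun n => {ω | q (u n) ω < ε}) n)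
  refine ⟨Tᶜ, hTm.compl, ?_, fun w hw => ?_⟩
  · rw [prob_compl_eq_one_sub hTm, tsub_pos_iff_lt, hT]
    refine lt_of_le_of_lt (sSup_le (a := ENNReal.ofReal (1 - l)) ?_)
      (ENNReal.ofReal_lt_one.2 (by linarith))
    rintro _ ⟨w, rfl⟩
    exact ENNReal.le_ofReal_iff_toReal_le (measure_ne_top _ _)
      (ENNReal.toReal_nonneg.trans (h w w.2)) |>.2 (h w w.2)
  -- Prepending `w` to the maximizing sequence cannot raise the probability of the union, so `{q w <
  -- ε} \ T` is null.
  · let u' : ℕ → K := fun n => if n = 0 then ⟨w, hw⟩ else u (n - 1)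
    have hsub : {ω | q w ω < ε} ∪ T ⊆ ⋃ n, {ω | q (u' n) ω < ε} := by
      rintro ω (hω | hω)
      · exact Set.mem_iUnion.2 ⟨0, hω⟩
      · obtain ⟨n, hn⟩ := Set.mem_iUnion.1 hω
        exact Set.mem_iUnion.2 ⟨n + 1, hn⟩
    have h0 : P (({ω | q w ω < ε} ∪ T) \ T) = 0 := by
      rw [measure_sdiff Set.subset_union_right hTm.nullMeasurableSet (measure_ne_top _ _),
        tsub_eq_zero_iff_le, hT]
      exact (measure_mono hsub).trans (hU u')
    filter_upwards [measure_eq_zero_iff_ae_notMem.1 h0] with ω h1 h2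
    by_contra h3
    exact h1 ⟨Or.inl (not_le.1 h3), h2⟩

/-- Separation of the origin from an `L⁰`-convex set, on a set of positive probability. -/
theorem IsSublinear.exists_separating [IsProbabilityMeasure P] {q : M → L0 P}
    (hq : IsSublinear q) (hq0 : ∀ x, 0 ≤ q x) {K : Set M} (hK : IsL0Convex (P := P) K)
    (hne : K.Nonempty) {ε l : ℝ} (hl : 0 < l)
    (h : ∀ w ∈ K, (P {ω | q w ω < ε}).toReal ≤ 1 - l) :
    ∃ D : Set Ω, MeasurableSet D ∧ 0 < P D ∧ (∀ w ∈ K, ∀ᵐ ω ∂P, ω ∈ D → ε ≤ q w ω) ∧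
      ∃ g : M →ₗ[L0 P] L0 P, (∀ x, g x ≤ q x) ∧ ∀ w ∈ K, ∀ᵐ ω ∂P, ω ∈ D → ε ≤ g w ω := by
  obtain ⟨D, hD, hPD, hqD⟩ := hq.exists_forall_le_on hK hne hl h
  have hd : ∀ᵐ ω ∂P, (ind P hD * L0.const P ε) ω = ind P hD ω * ε := by
    filter_upwards [L0.mul_ae (ind P hD) (L0.const P ε), L0.const_ae (P := P) ε] with ω h1 h2
    rw [h1, h2]
  obtain ⟨g, hg1, hg2⟩ := hq.exists_linear_le hK hne (d := ind P hD * L0.const P ε)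
    fun v hv => by
      rw [L0.le_iff]
      filter_upwards [hd, hqD v hv, L0.le_iff.1 (hq0 v), L0.zero_ae (P := P),
        ind_ae_mem (P := P) hD, ind_ae_notMem (P := P) hD] with ω h1 h2 h3 h4 h5 h6
      rw [h1]
      by_cases hω : ω ∈ D
      · rw [h5 hω, one_mul]; exact h2 hω
      · rw [h6 hω, zero_mul]; rwa [h4] at h3
  refine ⟨D, hD, hPD, hqD, g, hg1, fun w hw => ?_⟩
  filter_upwards [hd, L0.le_iff.1 (hg2 w hw), ind_ae_mem (P := P) hD] with ω h1 h2 h3 hω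
  rwa [h1, h3 hω, one_mul] at h2

end Separation

/-! ### The `(ε, λ)`-topology: neighbourhoods, continuous functionals, closed affine epigraphs. -/

section Topology

variable {Ω : Type*} [MeasurableSpace Ω] {P : Measure Ω} {E : Type*} [AddCommGroup E]
  [Module (L0 P) E]

theorem prob_inter_gt [IsProbabilityMeasure P] {A B : Set Ω} {a b : ℝ} (hB : MeasurableSet B)
    (hA' : 1 - a < (P A).toReal) (hB' : 1 - b < (P B).toReal) :
    1 - (a + b) < (P (A ∩ B)).toReal := by
  have h1 := measureReal_union_add_inter (μ := P) (s := A) hB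
  have h2 : P.real (A ∪ B) ≤ 1 := measureReal_le_one
  simp only [Measure.real] at h1 h2
  linarith

theorem measurableSet_forall_lt {F : Type*} (Q : Finset (F → L0 P)) (x : F) (ε : ℝ) :
    MeasurableSet {ω | ∀ p ∈ Q, p x ω < ε} := by
  have h : {ω | ∀ p ∈ Q, p x ω < ε} = ⋂ p ∈ Q, {ω | p x ω < ε} := by ext; simp
  rw [h]
  exact Q.measurableSet_biInter fun p _ => measurableSet_lt (L0.measurable _) measurable_const

theorem isL0Seminorm_abs : IsL0Seminorm fun ξ : L0 P => |ξ| where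
  nonneg := abs_nonneg
  smul ξ x := by
    apply AEEqFun.ext
    filter_upwards [L0.abs_ae (ξ • x), L0.mul_ae ξ x, L0.mul_ae |ξ| |x|, L0.abs_ae ξ, L0.abs_ae x]
      with ω h1 h2 h3 h4 h5
    rw [h1, h3, h4, h5, smul_eq_mul, h2, abs_mul]
  add_le := abs_add_le

theorem IsL0Seminorm.isSublinear {p : E → L0 P} (hp : IsL0Seminorm p) : IsSublinear p :=
  ⟨hp.add_le, fun ξ x hξ => by rw [hp.smul, abs_of_nonneg hξ]⟩

theorem zero_mem_epsLamNhd [IsProbabilityMeasure P] {Q : Finset (E → L0 P)}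
    (hQ : ∀ p ∈ Q, IsL0Seminorm p) {ε l : ℝ} (hε : 0 < ε) (hl : 0 < l) :
    (0 : E) ∈ epsLamNhd Q ε l := by
  have h : P {ω | ∀ p ∈ Q, p (0 : E) ω < ε} = 1 := by
    rw [← prob_compl_eq_zero_iff (measurableSet_forall_lt Q 0 ε)]
    have h1 : ∀ᵐ ω ∂P, ∀ p ∈ Q, p (0 : E) ω < ε := by
      rw [Finset.eventually_all]
      intro p hp
      filter_upwards [L0.zero_ae (P := P)] with ω h0
      rw [(hQ p hp).isSublinear.map_zero, h0]
      exact hε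
    exact h1
  simp only [epsLamNhd, Set.mem_ofPred_eq, h, ENNReal.toReal_one]
  linarith

theorem add_mem_epsLamNhd [IsProbabilityMeasure P] {Q : Finset (E → L0 P)}
    (hQ : ∀ p ∈ Q, IsL0Seminorm p) {ε l : ℝ} {x y : E} (hx : x ∈ epsLamNhd Q (ε / 2) (l / 2))
    (hy : y ∈ epsLamNhd Q (ε / 2) (l / 2)) : x + y ∈ epsLamNhd Q ε l := by
  have h := prob_inter_gt (measurableSet_forall_lt Q y (ε / 2)) hx hy
  rw [add_halves] at h
  refine h.trans_le (ENNReal.toReal_mono (measure_ne_top _ _) (measure_mono_ae ?_))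
  have hadd : ∀ᵐ ω ∂P, ∀ p ∈ Q, p (x + y) ω ≤ p x ω + p y ω := by
    rw [Finset.eventually_all]
    intro p hp
    filter_upwards [L0.le_iff.1 ((hQ p hp).add_le x y), L0.add_ae (p x) (p y)] with ω h1 h2
    rwa [h2] at h1
  filter_upwards [hadd] with ω h1 hω p hp
  have h2 := hω.1 p hp
  have h3 := hω.2 p hp
  have h4 := h1 p hp
  linarith

/-- The topology is given by its open sets, so an open set inside the translate must be exhibited:
the points that keep some basic neighbourhood of room. Halving the parameters shows that it is open.
-/
theorem epsLamNhd_mem_nhds [IsProbabilityMeasure P] {𝒮 : Set (E → L0 P)}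
    (h𝒮 : ∀ p ∈ 𝒮, IsL0Seminorm p) {Q : Finset (E → L0 P)} (hQ : (Q : Set (E → L0 P)) ⊆ 𝒮)
    {ε l : ℝ} (hε : 0 < ε) (hl : 0 < l) (x : E) :
    {z | z - x ∈ epsLamNhd Q ε l} ∈ @nhds E (epsLamTopology 𝒮) x := by
  let _ := epsLamTopology 𝒮
  have hQ' : ∀ p ∈ Q, IsL0Seminorm p := fun p hp => h𝒮 p (hQ hp)
  rw [mem_nhds_iff]
  refine ⟨{z | ∃ e k : ℝ, 0 < e ∧ 0 < k ∧ k < 1 ∧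
    ∀ y ∈ epsLamNhd Q e k, z + y - x ∈ epsLamNhd Q ε l}, ?_, ?_, ?_⟩
  · rintro z ⟨e, k, he, hk, -, h⟩
    simpa using h 0 (zero_mem_epsLamNhd hQ' he hk)
  · rintro z ⟨e, k, he, hk, hk1, h⟩
    refine ⟨Q, hQ, e / 2, k / 2, by positivity, by positivity, by linarith, fun y hy =>
      ⟨e / 2, k / 2, by positivity, by positivity, by linarith, fun y' hy' => ?_⟩⟩
    rw [add_assoc]
    exact h _ (add_mem_epsLamNhd hQ' hy hy')
  -- The minimum with `1 / 2` keeps the parameter below `1`, which is not assumed of `l`.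
  · refine ⟨ε, min l (1 / 2), hε, by positivity,
      (min_le_right _ _).trans_lt (by norm_num), fun y hy => ?_⟩
    rw [add_sub_cancel_left]
    exact (sub_le_sub_left (min_le_left l (1 / 2)) 1).trans_lt hy

/-- `g` is dominated by a multiple of a finite sum of members of `𝒮`. -/
def IsDominated (𝒮 : Set (E → L0 P)) (g : E →ₗ[L0 P] L0 P) : Prop :=
  ∃ Q : Finset (E → L0 P), (Q : Set (E → L0 P)) ⊆ 𝒮 ∧ ∃ ξ : L0 P, 0 ≤ ξ ∧
    ∀ x, |g x| ≤ ξ * ∑ p ∈ Q, p x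

theorem IsDominated.add {𝒮 : Set (E → L0 P)} (h𝒮 : ∀ p ∈ 𝒮, IsL0Seminorm p)
    {g g' : E →ₗ[L0 P] L0 P} (h : IsDominated 𝒮 g) (h' : IsDominated 𝒮 g') :
    IsDominated 𝒮 (g + g') := by
  classical
  obtain ⟨Q, hQ, ξ, hξ, h⟩ := h
  obtain ⟨Q', hQ', ξ', hξ', h'⟩ := h'
  have hQQ : ((Q ∪ Q' : Finset (E → L0 P)) : Set (E → L0 P)) ⊆ 𝒮 := by simp [hQ, hQ']
  refine ⟨Q ∪ Q', hQQ, ξ + ξ', add_nonneg hξ hξ', fun x => ?_⟩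
  have hle : ∀ R ⊆ Q ∪ Q', ∑ p ∈ R, p x ≤ ∑ p ∈ Q ∪ Q', p x := fun R hR =>
    Finset.sum_le_sum_of_subset_of_nonneg hR fun p hp _ => (h𝒮 p (hQQ hp)).nonneg x
  rw [add_mul]
  exact (abs_add_le _ _).trans (add_le_add
    ((h x).trans (mul_le_mul_of_nonneg_left (hle Q Finset.subset_union_left) hξ))
    ((h' x).trans (mul_le_mul_of_nonneg_left (hle Q' Finset.subset_union_right) hξ')))

theorem IsDominated.smul {𝒮 : Set (E → L0 P)} {g : E →ₗ[L0 P] L0 P} (h : IsDominated 𝒮 g)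
    (η : L0 P) : IsDominated 𝒮 (η • g) := by
  obtain ⟨Q, hQ, ξ, hξ, h⟩ := h
  refine ⟨Q, hQ, |η| * ξ, mul_nonneg (abs_nonneg _) hξ, fun x => ?_⟩
  have h1 : |(η • g) x| = |η| * |g x| := isL0Seminorm_abs.smul η (g x)
  rw [h1, mul_assoc]
  exact mul_le_mul_of_nonneg_left (h x) (abs_nonneg _)

theorem exists_prob_lt_gt [IsProbabilityMeasure P] (ξ : L0 P) {l : ℝ} (hl : 0 < l) :
    ∃ m : ℕ, 1 - l < (P {ω | ξ ω < m}).toReal := by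
  have hmono : Monotone fun m : ℕ => {ω | ξ ω < m} := fun a b hab ω (hω : ξ ω < a) =>
    hω.trans_le (by exact_mod_cast hab)
  have h := tendsto_measure_iUnion_atTop (μ := P) hmono
  have hU : (⋃ m : ℕ, {ω | ξ ω < m}) = Set.univ :=
    Set.eq_univ_of_forall fun ω => Set.mem_iUnion.2 (exists_nat_gt (ξ ω))
  rw [hU, measure_univ] at h
  have h2 := (ENNReal.tendsto_toReal ENNReal.one_ne_top).comp h
  rw [ENNReal.toReal_one] at h2
  exact (h2.eventually (lt_mem_nhds (show 1 - l < 1 by linarith))).exists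

theorem L0.sum_ae {ι : Type*} (Q : Finset ι) (a : ι → L0 P) :
    ∀ᵐ ω ∂P, (∑ i ∈ Q, a i) ω = ∑ i ∈ Q, a i ω :=
  AEEqFun.coeFn_fun_finsetSum Q a

/-- The factor `ξ` is unbounded in general, but it is below a constant `m` outside a set of
arbitrarily small probability, and convergence in probability needs no more. -/
theorem IsDominated.mem_randomConjugate [IsProbabilityMeasure P] {𝒮 : Set (E → L0 P)}
    (h𝒮 : ∀ p ∈ 𝒮, IsL0Seminorm p) {g : E →ₗ[L0 P] L0 P} (h : IsDominated 𝒮 g) :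
    g ∈ randomConjugate 𝒮 := by
  obtain ⟨Q, hQ, ξ, hξ, h⟩ := h
  let _ := epsLamTopology 𝒮
  let _ := epsLamTopologyL0 P
  have hcont : Continuous g := by
    refine continuous_def.2 fun U hU x hx => ?_
    obtain ⟨Q', hQ', ε, l, hε, hl, hl1, hU⟩ := hU (g x) hx
    obtain ⟨m, hm⟩ := exists_prob_lt_gt ξ (half_pos hl)
    have hpos : (0 : ℝ) < (m + 1) * (Q.card + 1) := by positivity
    -- Both `+ 1` avoid division by zero and make the final estimate strict.
    refine ⟨Q, hQ, ε / ((m + 1) * (Q.card + 1)), l / 2, by positivity, by positivity,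
      by linarith, fun y hy => ?_⟩
    rw [Set.mem_preimage, map_add]
    refine hU _ ?_
    have h1 := prob_inter_gt (measurableSet_lt (L0.measurable ξ) measurable_const) hy hm
    rw [add_halves] at h1
    refine h1.trans_le (ENNReal.toReal_mono (measure_ne_top _ _) (measure_mono_ae ?_))
    have hnn : ∀ᵐ ω ∂P, ∀ p ∈ Q, 0 ≤ p y ω := by
      rw [Finset.eventually_all]
      intro p hp
      filter_upwards [L0.le_iff.1 ((h𝒮 p (hQ hp)).nonneg y), L0.zero_ae (P := P)] with ω h1 h2
      rwa [h2] at h1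
    filter_upwards [hnn, L0.le_iff.1 (h y), L0.mul_ae ξ (∑ p ∈ Q, p y),
      L0.sum_ae Q fun p => p y, L0.le_iff.1 hξ, L0.zero_ae (P := P)]
      with ω e1 e2 e3 e4 e5 e6 hω p hp
    have hp' : p = fun ξ : L0 P => |ξ| := hQ' hp
    rw [hp']
    rw [e3, e4] at e2
    rw [e6] at e5
    have e7 : ∑ p ∈ Q, p y ω ≤ Q.card * (ε / ((m + 1) * (Q.card + 1))) := by
      rw [← nsmul_eq_mul]
      exact Finset.sum_le_card_nsmul _ _ _ fun p hp => (hω.1 p hp).le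
    have e8 : ξ ω < m := hω.2
    have e9 : 0 ≤ ∑ p ∈ Q, p y ω := Finset.sum_nonneg e1
    calc |g y| ω ≤ ξ ω * ∑ p ∈ Q, p y ω := e2
      _ ≤ m * (Q.card * (ε / ((m + 1) * (Q.card + 1)))) := by gcongr
      _ < (m + 1) * ((Q.card + 1) * (ε / ((m + 1) * (Q.card + 1)))) := by
        have : 0 < ε / ((m + 1) * (Q.card + 1)) := by positivity
        gcongr <;> linarith
      _ = ε := by field_simp
  exact hcont

/-- A failing inequality fails by a margin `2 / (n + 1)` on some set `B n` of positive probability.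
Changing `g x` and `r` by less than `1 / (n + 1)` each, outside an event of probability less than
that of `B n`, leaves it failing on part of `B n`. -/
theorem isClosed_affine [IsProbabilityMeasure P] {𝒮 : Set (E → L0 P)}
    {g : E →ₗ[L0 P] L0 P} (hg : g ∈ randomConjugate 𝒮) (c : L0bar P) {A : Set Ω}
    (hA : MeasurableSet A) :
    @IsClosed (E × L0 P)
      (@instTopologicalSpaceProd E (L0 P) (epsLamTopology 𝒮) (epsLamTopologyL0 P))
      {z | ∀ᵐ ω ∂P, ω ∈ A → ((g z.1 ω : ℝ) : EReal) - c ω ≤ ((z.2 ω : ℝ) : EReal)} := by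
  let _ := epsLamTopology 𝒮
  let _ := epsLamTopologyL0 P
  have hgc : Continuous g := hg
  rw [← isOpen_compl_iff, isOpen_iff_mem_nhds]
  rintro ⟨x, r⟩ hxr
  let B : ℕ → Set Ω := fun n =>
    {ω | ω ∈ A ∧ ((r ω + 2 * (1 / (n + 1)) : ℝ) : EReal) < ((g x ω : ℝ) : EReal) - c ω}
  have hBm : ∀ n, MeasurableSet (B n) := fun n => by
    refine hA.inter (s₂ := {ω | ((r ω + 2 * (1 / (n + 1)) : ℝ) : EReal) <
      ((g x ω : ℝ) : EReal) - c ω}) (measurableSet_lt ?_ ?_)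
    · have := L0.measurable r
      fun_prop
    · simp only [sub_eq_add_neg]
      have h1 := L0.measurable (g x)
      have h2 := L0bar.measurable c
      fun_prop
  have hB : ∃ n, P (B n) ≠ 0 := by
    by_contra! hcon
    refine hxr ?_
    filter_upwards [ae_all_iff.2 fun n => measure_eq_zero_iff_ae_notMem.1 (hcon n)] with ω hω hωA
    refine EReal.le_of_forall_lt_iff_le.1 fun z hz => ?_
    obtain ⟨n, hn⟩ := exists_nat_one_div_lt (show 0 < (z - r ω) / 2 by
      have : r ω < z := by exact_mod_cast hz
      linarith)
    have h2 := not_lt.1 fun h3 => hω n ⟨hωA, h3⟩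
    refine h2.trans ?_
    exact_mod_cast (by linarith : r ω + 2 * (1 / (n + 1)) ≤ z)
  obtain ⟨n, hn⟩ := hB
  have hpos : 0 < (P (B n)).toReal / 2 := half_pos (ENNReal.toReal_pos hn (measure_ne_top _ _))
  have hε : (0 : ℝ) < 1 / (n + 1) := by positivity
  have hQ : (({fun ξ : L0 P => |ξ|} : Finset (L0 P → L0 P)) : Set (L0 P → L0 P)) ⊆
      {fun ξ : L0 P => |ξ|} := by simp
  have hsem : ∀ p ∈ ({fun ξ : L0 P => |ξ|} : Set (L0 P → L0 P)), IsL0Seminorm p := by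
    rintro _ rfl
    exact isL0Seminorm_abs
  have hU := hgc.continuousAt.preimage_mem_nhds
    (epsLamNhd_mem_nhds hsem hQ hε (half_pos hpos) (g x))
  have hV := epsLamNhd_mem_nhds hsem hQ hε (half_pos hpos) r
  refine Filter.mem_of_superset (prod_mem_nhds hU hV) ?_
  rintro ⟨y, s⟩ ⟨hy, hs⟩ hys
  have h1 := prob_inter_gt (measurableSet_forall_lt _ _ _) hy hs
  rw [add_halves] at h1
  -- The two deficits, `P (B n) / 2` and `1 - P (B n) / 2`, add up to `1`, so the intersection has
  -- positive probability.
  have h2 := prob_inter_gt (hBm n) h1 (b := 1 - (P (B n)).toReal / 2) (by linarith)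
  rw [add_sub_cancel, sub_self] at h2
  refine (ENNReal.toReal_pos_iff.1 h2).1.ne' (measure_eq_zero_iff_ae_notMem.2 ?_)
  filter_upwards [hys, L0.abs_ae (g y - g x), L0.sub_ae (g y) (g x), L0.abs_ae (s - r),
    L0.sub_ae s r] with ω e1 e2 e3 e4 e5 hω
  obtain ⟨⟨h3, h4⟩, hωA, h5⟩ := hω
  have h3 : |g y - g x| ω < 1 / (n + 1) := h3 _ (Finset.mem_singleton_self _)
  have h4 : |s - r| ω < 1 / (n + 1) := h4 _ (Finset.mem_singleton_self _)
  rw [e2, e3] at h3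
  rw [e4, e5] at h4
  have h6 := e1 hωA
  generalize c ω = d at h5 h6
  induction d with
  | bot => simp at h6
  | top => simp at h5
  | coe d =>
    have h5 : r ω + 2 * (1 / (n + 1)) < g x ω - d := by exact_mod_cast h5
    have h6 : g y ω - d ≤ s ω := by exact_mod_cast h6
    have h7 := (abs_lt.1 h3).1
    have h8 := (abs_lt.1 h4).2
    linarith

end Topology

/-! ### The biconjugate is a closed minorant of `f`. -/

section Biconjugate

variable {Ω : Type*} [MeasurableSpace Ω] {P : Measure Ω} {E : Type*} [AddCommGroup E]
  [Module (L0 P) E]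

theorem map_ind_smul_ae (g : E →ₗ[L0 P] L0 P) {A : Set Ω} (hA : MeasurableSet A) (x : E) :
    ∀ᵐ ω ∂P, ω ∈ A → g (ind P hA • x) ω = g x ω := by
  filter_upwards [L0.mul_ae (ind P hA) (g x), ind_ae_mem (P := P) hA] with ω h1 h2 hω
  rw [map_smul, smul_eq_mul, h1, h2 hω, one_mul]

theorem le_conj [IsFiniteMeasure P] (f : E → L0bar P) (g : E →ₗ[L0 P] L0 P) (x : E) :
    ∀ᵐ ω ∂P, ((g x ω : ℝ) : EReal) - f x ω ≤ conj f g ω := by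
  filter_upwards [le_sup (S := Set.range fun x : E => realSub (g x) (f x)) ⟨x, rfl⟩,
    realSub_ae (g x) (f x)] with ω h1 h2
  rwa [h2] at h1

theorem conj_le_on [IsFiniteMeasure P] {f : E → L0bar P} {g : E →ₗ[L0 P] L0 P} {A : Set Ω}
    (hA : MeasurableSet A) {η : L0bar P}
    (h : ∀ x, ∀ᵐ ω ∂P, ω ∈ A → ((g x ω : ℝ) : EReal) - f x ω ≤ η ω) :
    ∀ᵐ ω ∂P, ω ∈ A → conj f g ω ≤ η ω := by
  refine sup_le_on hA ?_
  rintro _ ⟨x, rfl⟩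
  filter_upwards [h x, realSub_ae (g x) (f x)] with ω h1 h2
  rwa [h2]

theorem le_biconj [IsFiniteMeasure P] {𝒮 : Set (E → L0 P)} (f : E → L0bar P)
    {g : E →ₗ[L0 P] L0 P} (hg : g ∈ randomConjugate 𝒮) (x : E) :
    ∀ᵐ ω ∂P, ((g x ω : ℝ) : EReal) - conj f g ω ≤ biconj 𝒮 f x ω := by
  filter_upwards [le_sup (S := (fun g : E →ₗ[L0 P] L0 P => realSub (g x) (conj f g)) ''
    randomConjugate 𝒮) ⟨g, hg, rfl⟩, realSub_ae (g x) (conj f g)] with ω h1 h2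
  rwa [h2] at h1

theorem biconj_le_on [IsFiniteMeasure P] {𝒮 : Set (E → L0 P)} {f : E → L0bar P} {x : E}
    {A : Set Ω} (hA : MeasurableSet A) {η : L0bar P}
    (h : ∀ g ∈ randomConjugate 𝒮, ∀ᵐ ω ∂P, ω ∈ A → ((g x ω : ℝ) : EReal) - conj f g ω ≤ η ω) :
    ∀ᵐ ω ∂P, ω ∈ A → biconj 𝒮 f x ω ≤ η ω := by
  refine sup_le_on hA ?_
  rintro _ ⟨g, hg, rfl⟩
  filter_upwards [h g hg, realSub_ae (g x) (conj f g)] with ω h1 h2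
  rwa [h2]

theorem coe_sub_le_comm {a : ℝ} {b c : EReal} (h : (a : EReal) - b ≤ c) : (a : EReal) - c ≤ b := by
  induction c with
  | bot =>
    induction b with
    | bot => simp at h
    | top => simp
    | coe b => exact absurd (le_bot_iff.1 h) (EReal.coe_ne_bot (a - b))
  | top => simp
  | coe c =>
    induction b with
    | bot => simp at h
    | top => simp
    | coe b =>
      rw [← EReal.coe_sub, EReal.coe_le_coe_iff] at h ⊢
      linarith

theorem biconj_le [IsFiniteMeasure P] (𝒮 : Set (E → L0 P)) (f : E → L0bar P) :
    biconj 𝒮 f ≤ f := by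
  intro x
  rw [← AEEqFun.coeFn_le]
  have h := biconj_le_on (𝒮 := 𝒮) (f := f) (x := x) (η := f x) MeasurableSet.univ fun g _ => by
    filter_upwards [le_conj f g x] with ω h _
    exact coe_sub_le_comm h
  filter_upwards [h] with ω h
  exact h trivial

theorem isLocal_biconj [IsFiniteMeasure P] (𝒮 : Set (E → L0 P)) (f : E → L0bar P) :
    IsLocal (biconj 𝒮 f) := by
  intro x A hA
  have h1 := biconj_le_on (𝒮 := 𝒮) (f := f) (x := x) (η := biconj 𝒮 f (ind P hA • x)) hA
    fun g hg => by
      filter_upwards [le_biconj f hg (ind P hA • x), map_ind_smul_ae g hA x] with ω h1 h2 hω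
      rwa [h2 hω] at h1
  have h2 := biconj_le_on (𝒮 := 𝒮) (f := f) (x := ind P hA • x) (η := biconj 𝒮 f x) hA
    fun g hg => by
      filter_upwards [le_biconj f hg x, map_ind_smul_ae g hA x] with ω h1 h2 hω
      rwa [h2 hω]
  filter_upwards [h1, h2] with ω h1 h2 hω
  exact le_antisymm (h1 hω) (h2 hω)

theorem isEssSup_MI [IsFiniteMeasure P] {F : Type*} (f : F → L0bar P) :
    IsEssSup P {A | MeasurableSet A ∧ ∃ x, ∀ᵐ ω ∂P, ω ∈ A → f x ω = ⊥} (MI f) :=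
  isEssSup_essSupSet _ fun _ h => h.1

theorem isEssSup_PI [IsFiniteMeasure P] {F : Type*} (f : F → L0bar P) :
    IsEssSup P {A | MeasurableSet A ∧ ∀ x, ∀ᵐ ω ∂P, ω ∈ A → f x ω = ⊤} (PI f) :=
  isEssSup_essSupSet _ fun _ h => h.1

/-- If the biconjugate is `-∞` on `A` at one point, then `conj f g = ⊤` on `A` for every continuous
`g`, and so it is `-∞` on `A` at every point. -/
theorem biconj_eq_bot [IsFiniteMeasure P] (𝒮 : Set (E → L0 P)) (f : E → L0bar P) (x : E) :
    ∀ᵐ ω ∂P, ω ∈ MI (biconj 𝒮 f) → biconj 𝒮 f x ω = ⊥ := by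
  have hB : MeasurableSet {ω | biconj 𝒮 f x ω = ⊥} :=
    L0bar.measurable _ (measurableSet_singleton _)
  refine (isEssSup_MI (biconj 𝒮 f)).2.2 _ hB ?_
  rintro A ⟨hA, y, hy⟩
  have h := biconj_le_on (𝒮 := 𝒮) (f := f) (x := x) (η := AEEqFun.const Ω ⊥) hA fun g hg => by
    filter_upwards [le_biconj f hg y, hy] with ω h1 h2 hω
    rw [h2 hω] at h1
    generalize conj f g ω = c at h1 ⊢
    induction c with
    | bot => simp at h1
    | top => simp
    | coe c => exact absurd (le_bot_iff.1 h1) (EReal.coe_ne_bot (g y ω - c))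
  filter_upwards [h, AEEqFun.coeFn_const (μ := P) Ω (⊥ : EReal)] with ω h1 h2 hω
  have h3 := h1 hω
  rw [h2] at h3
  exact le_bot_iff.1 h3

theorem coe_sub_le_convex {a b t : ℝ} (ht0 : 0 ≤ t) (ht1 : t ≤ 1) {c u v : EReal}
    (hu : (a : EReal) - c ≤ u) (hv : (b : EReal) - c ≤ v) (hu' : ⊥ < u) (hv' : ⊥ < v) :
    ((t * a + (1 - t) * b : ℝ) : EReal) - c ≤ (t : EReal) * u + ((1 - t : ℝ) : EReal) * v := by
  induction c with
  | top => simp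
  | bot =>
    have hu : u = ⊤ := by simpa using hu
    have hv : v = ⊤ := by simpa using hv
    subst hu hv
    -- Both values are `⊤` and at least one weight is positive, so the convention `0 * ⊤ = 0` does
    -- no harm.
    rcases ht0.eq_or_lt with rfl | h0
    · simp
    · rw [EReal.coe_mul_top_of_pos h0]
      rcases (sub_nonneg.2 ht1).eq_or_lt with h1 | h1
      · simp [← h1]
      · rw [EReal.coe_mul_top_of_pos h1]; simp
  | coe c =>
    have h1 : (t : EReal) * ((a : EReal) - c) ≤ t * u :=
      mul_le_mul_of_nonneg_left hu (by exact_mod_cast ht0)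
    have h2 : ((1 - t : ℝ) : EReal) * ((b : EReal) - c) ≤ ((1 - t : ℝ) : EReal) * v :=
      mul_le_mul_of_nonneg_left hv (by exact_mod_cast sub_nonneg.2 ht1)
    refine le_trans (le_of_eq ?_) (add_le_add h1 h2)
    rw [← EReal.coe_sub, ← EReal.coe_sub, ← EReal.coe_sub, ← EReal.coe_mul, ← EReal.coe_mul,
      ← EReal.coe_add]
    congr 1
    ring

theorem isConvexOn_biconj [IsFiniteMeasure P] (𝒮 : Set (E → L0 P)) (f : E → L0bar P)
    {A : Set Ω} (hA : MeasurableSet A) (hprop : IsProperOn hA (biconj 𝒮 f)) :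
    IsConvexOn hA (biconj 𝒮 f) := by
  intro x hx y hy ξ h0 h1
  have hm : Measurable fun ω => ((ξ ω : ℝ) : EReal) * biconj 𝒮 f x ω +
      ((1 - ξ ω : ℝ) : EReal) * biconj 𝒮 f y ω := by
    have e1 := L0.measurable ξ
    have e2 := L0bar.measurable (biconj 𝒮 f x)
    have e3 := L0bar.measurable (biconj 𝒮 f y)
    fun_prop
  have h := biconj_le_on (𝒮 := 𝒮) (f := f) (x := ξ • x + (1 - ξ) • y)
    (η := AEEqFun.mk _ hm.aestronglyMeasurable) hA fun g hg => by
      filter_upwards [le_biconj f hg x, le_biconj f hg y, hprop.2 x hx, hprop.2 y hy,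
        L0.le_iff.1 h0, L0.le_iff.1 h1, L0.zero_ae (P := P), L0.one_ae (P := P),
        L0.add_ae (ξ * g x) ((1 - ξ) * g y), L0.mul_ae ξ (g x), L0.mul_ae (1 - ξ) (g y),
        L0.sub_ae 1 ξ, AEEqFun.coeFn_mk (μ := P) _ hm.aestronglyMeasurable]
        with ω e1 e2 e3 e4 e5 e6 e7 e8 e9 e10 e11 e12 e13 hω
      rw [e7] at e5
      rw [e8] at e6
      rw [e13, map_add, map_smul, map_smul, smul_eq_mul, smul_eq_mul, e9, e10, e11, e12, e8]
      exact coe_sub_le_convex e5 e6 e1 e2 (e3 hω) (e4 hω)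
  filter_upwards [h, AEEqFun.coeFn_mk (μ := P) _ hm.aestronglyMeasurable] with ω e1 e2 hω
  have e3 := e1 hω
  rwa [e2] at e3

/-- The epigraph of a supremum is the intersection of the epigraphs, here of functions covered by
`isClosed_affine`. -/
theorem isLscOn_biconj [IsProbabilityMeasure P] (𝒮 : Set (E → L0 P)) (f : E → L0bar P)
    {A : Set Ω} (hA : MeasurableSet A) : IsLscOn 𝒮 hA (biconj 𝒮 f) := by
  let _ := epsLamTopology 𝒮
  let _ := epsLamTopologyL0 P
  refine ⟨⋂ g ∈ randomConjugate 𝒮, {z | ∀ᵐ ω ∂P, ω ∈ A →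
    ((g z.1 ω : ℝ) : EReal) - conj f g ω ≤ ((z.2 ω : ℝ) : EReal)},
    isClosed_biInter fun g hg => isClosed_affine hg _ hA, ?_⟩
  ext ⟨x, r⟩
  simp only [epiOn, Set.mem_ofPred_eq, Set.mem_inter_iff, Set.mem_iInter, Set.mem_prod]
  constructor
  · rintro ⟨hx, hr, h⟩
    refine ⟨fun g hg => ?_, hx, hr⟩
    filter_upwards [h, le_biconj f hg x] with ω h1 h2 hω
    exact h2.trans (h1 hω)
  · rintro ⟨h, hx, hr⟩
    refine ⟨hx, hr, ?_⟩
    have h' := biconj_le_on (𝒮 := 𝒮) (f := f) (x := x) (η := r.toBar) hA fun g hg => by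
      filter_upwards [h g hg, r.toBar_ae] with ω h1 h2 hω
      rw [h2]
      exact h1 hω
    filter_upwards [h', r.toBar_ae] with ω h1 h2 hω
    rw [← h2]
    exact h1 hω

theorem isClosedFunction_biconj [IsProbabilityMeasure P] (𝒮 : Set (E → L0 P))
    (f : E → L0bar P) : IsClosedFunction 𝒮 (biconj 𝒮 f) where
  isLocal := isLocal_biconj 𝒮 f
  eq_bot := biconj_eq_bot 𝒮 f
  convex_lsc _ hA _ _ hprop := ⟨isConvexOn_biconj 𝒮 f hA hprop, isLscOn_biconj 𝒮 f hA⟩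

end Biconjugate

/-! ### Closed minorants of `f` lie below the biconjugate. -/

section FenchelMoreau

variable {Ω : Type*} [MeasurableSpace Ω] {P : Measure Ω} {E : Type*} [AddCommGroup E]
  [Module (L0 P) E]

theorem ind_compl {A : Set Ω} (hA : MeasurableSet A) : ind P hA.compl = 1 - ind P hA := by
  apply AEEqFun.ext
  filter_upwards [ind_ae (P := P) hA, ind_ae (P := P) hA.compl, L0.sub_ae 1 (ind P hA),
    L0.one_ae (P := P)] with ω h1 h2 h3 h4
  rw [h3, h1, h2, h4]
  by_cases h : ω ∈ A <;> simp [h]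

theorem ind_smul_glue {A : Set Ω} (hA : MeasurableSet A) (y z : E) :
    ind P hA • (ind P hA • y + (1 - ind P hA) • z) = ind P hA • y := by
  rw [smul_add, smul_smul, smul_smul, ind_mul_ind, mul_sub, mul_one, ind_mul_ind, sub_self,
    zero_smul, add_zero]

theorem ind_compl_smul_glue {A : Set Ω} (hA : MeasurableSet A) (y z : E) :
    ind P hA.compl • (ind P hA • y + (1 - ind P hA) • z) = ind P hA.compl • z := by
  have h : (1 - ind P hA) * (1 - ind P hA) = 1 - ind P hA := by
    rw [mul_sub, mul_one, sub_mul, one_mul, ind_mul_ind, sub_self, sub_zero]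
  rw [ind_compl, smul_add, smul_smul, smul_smul, h, sub_mul, one_mul, ind_mul_ind, sub_self,
    zero_smul, zero_add]

theorem IsLocal.glue_mem {k : E → L0bar P} (hk : IsLocal k) {A : Set Ω} (hA : MeasurableSet A)
    (y z : E) : ∀ᵐ ω ∂P, ω ∈ A → k (ind P hA • y + (1 - ind P hA) • z) ω = k y ω := by
  have h := hk (ind P hA • y + (1 - ind P hA) • z) A hA
  rw [ind_smul_glue] at h
  filter_upwards [h, hk y A hA] with ω h1 h2 hω
  rw [h1 hω, h2 hω]

theorem IsLocal.glue_notMem {k : E → L0bar P} (hk : IsLocal k) {A : Set Ω}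
    (hA : MeasurableSet A) (y z : E) :
    ∀ᵐ ω ∂P, ω ∉ A → k (ind P hA • y + (1 - ind P hA) • z) ω = k z ω := by
  have h := hk (ind P hA • y + (1 - ind P hA) • z) Aᶜ hA.compl
  rw [ind_compl_smul_glue] at h
  filter_upwards [h, hk z Aᶜ hA.compl] with ω h1 h2 hω
  rw [h1 hω, h2 hω]

theorem ind_smul_mem_part {A : Set Ω} (hA : MeasurableSet A) (x : E) :
    ind P hA • x ∈ part P E hA := ⟨x, rfl⟩

theorem part_convex {A : Set Ω} (hA : MeasurableSet A) :
    IsL0Convex (P := P) (part P E hA) := by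
  rintro _ ⟨x, rfl⟩ _ ⟨y, rfl⟩ ξ - -
  refine ⟨ξ • x + (1 - ξ) • y, ?_⟩
  simp only [smul_add, smul_comm (ind P hA)]

theorem IsConvexOn.epiOn_convex {A : Set Ω} {hA : MeasurableSet A} {k : E → L0bar P}
    (hk : IsConvexOn hA k) : IsL0Convex (P := P) (epiOn hA k) := by
  rintro ⟨x, r⟩ ⟨hx, hr, hxr⟩ ⟨y, s⟩ ⟨hy, hs, hys⟩ ξ h0 h1
  refine ⟨part_convex hA x hx y hy ξ h0 h1, part_convex hA r hr s hs ξ h0 h1, ?_⟩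
  filter_upwards [hk x hx y hy ξ h0 h1, hxr, hys, L0.le_iff.1 h0, L0.le_iff.1 h1,
    L0.zero_ae (P := P), L0.one_ae (P := P), L0.add_ae (ξ * r) ((1 - ξ) * s), L0.mul_ae ξ r,
    L0.mul_ae (1 - ξ) s, L0.sub_ae 1 ξ] with ω e1 e2 e3 e4 e5 e6 e7 e8 e9 e10 e11 hω
  rw [e6] at e4
  rw [e7] at e5
  have hval : (ξ • (x, r) + (1 - ξ) • (y, s)).2 ω = ξ ω * r ω + (1 - ξ ω) * s ω := by
    simp only [Prod.smul_mk, Prod.mk_add_mk, smul_eq_mul]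
    rw [e8, e9, e10, e11, e7]
  rw [hval, EReal.coe_add, EReal.coe_mul, EReal.coe_mul]
  refine (e1 hω).trans (add_le_add ?_ ?_)
  · exact mul_le_mul_of_nonneg_left (e2 hω) (by exact_mod_cast e4)
  · exact mul_le_mul_of_nonneg_left (e3 hω) (by exact_mod_cast sub_nonneg.2 e5)

theorem IsLocal.ind_smul_mem_epiOn {k : E → L0bar P} (hk : IsLocal k) {A : Set Ω}
    (hA : MeasurableSet A) {y : E} {s : L0 P}
    (h : ∀ᵐ ω ∂P, ω ∈ A → k y ω ≤ ((s ω : ℝ) : EReal)) :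
    ind P hA • (y, s) ∈ epiOn hA k := by
  refine ⟨ind_smul_mem_part hA y, ind_smul_mem_part hA s, ?_⟩
  filter_upwards [h, hk y A hA, L0.mul_ae (ind P hA) s, ind_ae_mem (P := P) hA]
    with ω h1 h2 h3 h4 hω
  have hval : (ind P hA • (y, s)).2 ω = s ω := by
    rw [Prod.smul_mk, smul_eq_mul, h3, h4 hω, one_mul]
  rw [hval, Prod.smul_mk, ← h2 hω]
  exact h1 hω

/-- The seminorm `(x, r) ↦ ∑ p x + |r|` on `E × L⁰`. -/
def prodSeminorm (Q : Finset (E → L0 P)) (z : E × L0 P) : L0 P := ∑ p ∈ Q, p z.1 + |z.2|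

theorem isL0Seminorm_prodSeminorm {Q : Finset (E → L0 P)} (hQ : ∀ p ∈ Q, IsL0Seminorm p) :
    IsL0Seminorm (prodSeminorm Q) where
  nonneg z := add_nonneg (Finset.sum_nonneg fun p hp => (hQ p hp).nonneg _) (abs_nonneg _)
  smul ξ z := by
    have h : |ξ • z.2| = |ξ| * |z.2| := isL0Seminorm_abs.smul ξ z.2
    rw [prodSeminorm, prodSeminorm, Prod.smul_fst, Prod.smul_snd, h, mul_add, Finset.mul_sum,
      Finset.sum_congr rfl fun p hp => (hQ p hp).smul ξ z.1]
  add_le z w := by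
    have h : ∑ p ∈ Q, p (z.1 + w.1) ≤ ∑ p ∈ Q, p z.1 + ∑ p ∈ Q, p w.1 := by
      rw [← Finset.sum_add_distrib]
      exact Finset.sum_le_sum fun p hp => (hQ p hp).add_le _ _
    exact (add_le_add h (abs_add_le z.2 w.2)).trans (le_of_eq (add_add_add_comm _ _ _ _))

theorem IsL0Seminorm.map_neg {p : E → L0 P} (hp : IsL0Seminorm p) (x : E) : p (-x) = p x := by
  have h := hp.smul (-1) x
  rwa [neg_smul, one_smul, abs_neg, abs_of_nonneg (zero_le_one' (L0 P)), one_mul] at h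

/-- On `E × {0}` the bound has no `|r|` term, and since seminorms are even, a one-sided bound on a
linear map bounds its absolute value. -/
theorem isDominated_of_le_prodSeminorm {𝒮 : Set (E → L0 P)} (h𝒮 : ∀ p ∈ 𝒮, IsL0Seminorm p)
    {Q : Finset (E → L0 P)} (hQ : (Q : Set (E → L0 P)) ⊆ 𝒮) {g : E × L0 P →ₗ[L0 P] L0 P}
    (hg : ∀ z, g z ≤ prodSeminorm Q z) :
    IsDominated 𝒮 (g ∘ₗ LinearMap.inl (L0 P) E (L0 P)) := by
  have h : ∀ x, g (x, 0) ≤ ∑ p ∈ Q, p x := fun x => by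
    simpa [prodSeminorm] using hg (x, 0)
  refine ⟨Q, hQ, 1, zero_le_one, fun x => ?_⟩
  rw [one_mul]
  refine sup_le (h x) ?_
  have h1 := h (-x)
  have h2 : g (-x, 0) = -g (x, 0) := by rw [← _root_.map_neg, Prod.neg_mk, neg_zero]
  rw [h2, Finset.sum_congr rfl fun p hp => (h𝒮 p (hQ hp)).map_neg x] at h1
  exact h1

theorem prodSeminorm_lt {Q : Finset (E → L0 P)} (hQ : ∀ p ∈ Q, IsL0Seminorm p) (z : E × L0 P)
    (ε : ℝ) : ∀ᵐ ω ∂P, prodSeminorm Q z ω < ε → (∀ p ∈ Q, p z.1 ω < ε) ∧ |z.2 ω| < ε := by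
  have hnn : ∀ᵐ ω ∂P, ∀ p ∈ Q, 0 ≤ p z.1 ω := by
    rw [Finset.eventually_all]
    intro p hp
    filter_upwards [L0.le_iff.1 ((hQ p hp).nonneg z.1), L0.zero_ae (P := P)] with ω h1 h2
    rwa [h2] at h1
  filter_upwards [hnn, L0.add_ae (∑ p ∈ Q, p z.1) |z.2|, L0.sum_ae Q fun p => p z.1,
    L0.abs_ae z.2] with ω h1 h2 h3 h4 h5
  rw [prodSeminorm, h2, h3, h4] at h5
  refine ⟨fun p hp => ?_, ?_⟩
  · have := Finset.single_le_sum h1 hp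
    have := abs_nonneg (z.2 ω)
    linarith
  · have := Finset.sum_nonneg h1
    linarith

/-- The point `(x, r)` strictly below the graph of a closed function is separated from its
epigraph, on a set of positive probability. -/
theorem IsClosedFunction.exists_separating_epi [IsProbabilityMeasure P] {𝒮 : Set (E → L0 P)}
    (h𝒮 : ∀ p ∈ 𝒮, IsL0Seminorm p) {k : E → L0bar P} (hk : IsClosedFunction 𝒮 k) {C : Set Ω}
    (hC : MeasurableSet C) (hCk : C ⊆ BP k) (hPC : 0 < P C) {y₁ : E}
    (hy₁ : ∀ᵐ ω ∂P, ω ∈ C → k y₁ ω < ⊤) (hbot : ∀ y, ∀ᵐ ω ∂P, ω ∈ C → ⊥ < k y ω) {x : E}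
    {r : L0 P} (hr : ∀ᵐ ω ∂P, ω ∈ C → ((r ω : ℝ) : EReal) < k x ω) :
    ∃ D ⊆ C, MeasurableSet D ∧ 0 < P D ∧ ∃ G : E →ₗ[L0 P] L0 P, IsDominated 𝒮 G ∧
      ∃ β : L0 P, ∃ ε : ℝ, 0 < ε ∧ ∀ (y : E) (s : L0 P),
        (∀ᵐ ω ∂P, ω ∈ C → k y ω ≤ ((s ω : ℝ) : EReal)) →
        ∀ᵐ ω ∂P, ω ∈ D → ε ≤ G x ω - G y ω + β ω * (r ω - s ω) := by
  have hprop : IsProperOn hC k := by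
    refine ⟨⟨_, ind_smul_mem_part hC y₁, ?_⟩, fun y _ => hbot y⟩
    filter_upwards [hy₁, hk.isLocal y₁ C hC] with ω h1 h2 hω
    rw [← h2 hω]
    exact h1 hω
  obtain ⟨hconv, F, hF, hepi⟩ := hk.convex_lsc C hC hCk hPC hprop
  -- Lower semicontinuity only concerns `E^C × Ĩ_C L⁰`, so the point is first cut down to `C`.
  set z₀ : E × L0 P := ind P hC • (x, r) with hz₀
  have hz₀F : z₀ ∉ F := by
    intro hz
    have h : z₀ ∈ epiOn hC k := by
      rw [hepi]
      exact ⟨hz, ind_smul_mem_part hC x, ind_smul_mem_part hC r⟩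
    refine hPC.ne' (measure_eq_zero_iff_ae_notMem.2 ?_)
    filter_upwards [h.2.2, hr, hk.isLocal x C hC, L0.mul_ae (ind P hC) r,
      ind_ae_mem (P := P) hC] with ω h1 h2 h3 h4 h5 hω
    have hval : z₀.2 ω = r ω := by
      rw [hz₀, Prod.smul_mk, smul_eq_mul, h4, h5 hω, one_mul]
    have h6 := h1 hω
    rw [hval, hz₀, Prod.smul_mk, ← h3 hω] at h6
    exact absurd (h2 hω) (not_lt.2 h6)
  obtain ⟨U, V, hU, hV, hzU, hzV, hUV⟩ :=
    (@isOpen_prod_iff E (L0 P) (epsLamTopology 𝒮) (epsLamTopologyL0 P) _).1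
      hF.isOpen_compl z₀.1 z₀.2 hz₀F
  obtain ⟨Q, hQ, ε, l, hε, hl, -, hQU⟩ := hU _ hzU
  obtain ⟨Q', hQ', ε', l', hε', hl', -, hQV⟩ := hV _ hzV
  have hQs : ∀ p ∈ Q, IsL0Seminorm p := fun p hp => h𝒮 p (hQ hp)
  have hq := isL0Seminorm_prodSeminorm hQs
  -- Translating by `-z₀` makes the origin the point to be separated.
  let K : Set (E × L0 P) := {w | z₀ + w ∈ epiOn hC k}
  have hK : IsL0Convex (P := P) K := by
    intro v hv w hw ξ h0 h1
    have h := hconv.epiOn_convex _ hv _ hw ξ h0 h1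
    have e : ξ • (z₀ + v) + (1 - ξ) • (z₀ + w) = z₀ + (ξ • v + (1 - ξ) • w) := by
      module
    rw [e] at h
    exact h
  have hmem : ∀ (y : E) (s : L0 P), (∀ᵐ ω ∂P, ω ∈ C → k y ω ≤ ((s ω : ℝ) : EReal)) →
      ind P hC • ((y, s) - (x, r)) ∈ K := by
    intro y s h
    have := hk.isLocal.ind_smul_mem_epiOn hC h
    change z₀ + ind P hC • ((y, s) - (x, r)) ∈ epiOn hC k
    rwa [smul_sub, ← hz₀, add_sub_cancel]
  have hs₁ : ∀ᵐ ω ∂P, ω ∈ C → k y₁ ω ≤ (((k y₁).toReal ω : ℝ) : EReal) := by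
    filter_upwards [hy₁, (k y₁).toReal_ae] with ω h1 h2 hω
    rw [h2]
    exact EReal.le_coe_toReal (h1 hω).ne
  have hfar : ∀ w ∈ K, (P {ω | prodSeminorm Q w ω < min ε ε'}).toReal ≤ 1 - min l l' := by
    intro w hw
    by_contra! hcon
    have hw' : z₀ + w ∈ F := by
      have h : z₀ + w ∈ epiOn hC k := hw
      rw [hepi] at h
      exact h.1
    refine hUV (Set.mk_mem_prod (hQU w.1 ?_) (hQV w.2 ?_)) hw'
    · refine (sub_le_sub_left (min_le_left l l') 1).trans_lt (hcon.trans_le ?_)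
      refine ENNReal.toReal_mono (measure_ne_top _ _) (measure_mono_ae ?_)
      filter_upwards [prodSeminorm_lt hQs w (min ε ε')] with ω h1 h2 p hp
      exact ((h1 h2).1 p hp).trans_le (min_le_left _ _)
    · refine (sub_le_sub_left (min_le_right l l') 1).trans_lt (hcon.trans_le ?_)
      refine ENNReal.toReal_mono (measure_ne_top _ _) (measure_mono_ae ?_)
      filter_upwards [prodSeminorm_lt hQs w (min ε ε'), L0.abs_ae w.2] with ω h1 h3 h2 p hp
      have hp' : p = fun ξ : L0 P => |ξ| := hQ' hp
      rw [hp']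
      exact h3.trans_lt ((h1 h2).2.trans_le (min_le_right _ _))
  obtain ⟨D, hD, hPD, hqD, g, hg, hgD⟩ := hq.isSublinear.exists_separating hq.nonneg hK
    ⟨_, hmem y₁ _ hs₁⟩ (lt_min hl hl') hfar
  -- The vectors used from `K` are multiples of the indicator of `C`; their seminorm is `0` off `C`
  -- but at least `min ε ε'` on `D`.
  have hDC : D ≤ᵐ[P] (D ∩ C : Set Ω) := by
    have h := hq.isSublinear.smul_le (ind P hC) ((y₁, (k y₁).toReal) - (x, r)) (ind_nonneg hC)
    filter_upwards [hqD _ (hmem y₁ _ hs₁), L0.le_iff.1 h, L0.mul_ae (ind P hC)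
      (prodSeminorm Q ((y₁, (k y₁).toReal) - (x, r))), ind_ae_notMem (P := P) hC]
      with ω h1 h2 h3 h4 hω
    refine ⟨hω, ?_⟩
    by_contra hωC
    rw [h3, h4 hωC, zero_mul] at h2
    have h5 := (lt_min hε hε').trans_le (h1 hω)
    exact absurd h2 (not_le.2 h5)
  -- The signs are reversed so that `G x - G y` and `β * (r - s)` are the two parts of `g` at `(y,
  -- s) - (x, r)`.
  refine ⟨D ∩ C, Set.inter_subset_right, hD.inter hC, hPD.trans_le (measure_mono_ae hDC),
    (-1 : L0 P) • (g ∘ₗ LinearMap.inl (L0 P) E (L0 P)),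
    (isDominated_of_le_prodSeminorm h𝒮 hQ hg).smul _, -g (0, 1), min ε ε', lt_min hε hε', ?_⟩
  intro y s hys
  have hdec : g ((y, s) - (x, r)) = g (y, 0) - g (x, 0) + (s - r) * g (0, 1) := by
    rw [← smul_eq_mul (s - r), ← LinearMap.map_smul, ← map_sub, ← map_add]
    congr 1
    simp
  filter_upwards [hgD _ (hmem y s hys), map_ind_smul_ae g hC ((y, s) - (x, r)),
    L0.add_ae (g (y, 0) - g (x, 0)) ((s - r) * g (0, 1)), L0.sub_ae (g (y, 0)) (g (x, 0)),
    L0.mul_ae (s - r) (g (0, 1)), L0.sub_ae s r, L0.neg_ae (g (0, 1)), L0.neg_ae (g (x, 0)),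
    L0.neg_ae (g (y, 0))] with ω h1 h2 h3 h4 h5 h6 h7 h8 h9 hω
  have h10 := h1 hω.1
  rw [h2 hω.2, hdec, h3, h4, h5, h6] at h10
  have h11 : ∀ z, ((-1 : L0 P) • (g ∘ₗ LinearMap.inl (L0 P) E (L0 P))) z = -g (z, 0) := by
    intro z; simp
  rw [h11, h11, h7, h8, h9]
  linarith

theorem nonpos_of_forall_nat_le {e a b c : ℝ} (h : ∀ n : ℕ, e ≤ a + b * (c - n)) : b ≤ 0 := by
  by_contra! hb
  obtain ⟨n, hn⟩ := exists_nat_gt ((a + b * c - e) / b)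
  rw [div_lt_iff₀ hb] at hn
  have := h n
  nlinarith

/-- The epigraph is unbounded upwards: raising the height over `y₁` by every `n` forces `β ≤ 0`.
Splicing then extends the inequality to points at which `k` is infinite on part of `C`. -/
theorem IsClosedFunction.exists_separating [IsProbabilityMeasure P] {𝒮 : Set (E → L0 P)}
    (h𝒮 : ∀ p ∈ 𝒮, IsL0Seminorm p) {k : E → L0bar P} (hk : IsClosedFunction 𝒮 k) {C : Set Ω}
    (hC : MeasurableSet C) (hCk : C ⊆ BP k) (hPC : 0 < P C) {y₁ : E}
    (hy₁ : ∀ᵐ ω ∂P, ω ∈ C → k y₁ ω < ⊤) (hbot : ∀ y, ∀ᵐ ω ∂P, ω ∈ C → ⊥ < k y ω) {x : E}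
    {r : L0 P} (hr : ∀ᵐ ω ∂P, ω ∈ C → ((r ω : ℝ) : EReal) < k x ω) :
    ∃ D ⊆ C, MeasurableSet D ∧ 0 < P D ∧ ∃ G : E →ₗ[L0 P] L0 P, IsDominated 𝒮 G ∧
      ∃ β : L0 P, ∃ ε : ℝ, 0 < ε ∧ (∀ᵐ ω ∂P, ω ∈ D → β ω ≤ 0) ∧ ∀ y, ∀ᵐ ω ∂P, ω ∈ D →
        k y ω < ⊤ → ε ≤ G x ω - G y ω + β ω * (r ω - (k y ω).toReal) := by
  obtain ⟨D, hDC, hD, hPD, G, hG, β, ε, hε, hsep⟩ :=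
    hk.exists_separating_epi h𝒮 hC hCk hPC hy₁ hbot hr
  refine ⟨D, hDC, hD, hPD, G, hG, β, ε, hε, ?_, fun y => ?_⟩
  · have h : ∀ n : ℕ, ∀ᵐ ω ∂P, ω ∈ D →
        ε ≤ G x ω - G y₁ ω + β ω * (r ω - (k y₁ ω).toReal - n) := fun n => by
      have hval : ∀ᵐ ω ∂P, ((k y₁).toReal + L0.const P n) ω = (k y₁ ω).toReal + n := by
        filter_upwards [L0.add_ae (k y₁).toReal (L0.const P n), (k y₁).toReal_ae,
          L0.const_ae (P := P) n] with ω h1 h2 h3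
        rw [h1, h2, h3]
      have h1 := hsep y₁ ((k y₁).toReal + L0.const P n) (by
        filter_upwards [hy₁, hval] with ω h1 h2 hω
        rw [h2]
        refine (EReal.le_coe_toReal (h1 hω).ne).trans ?_
        exact_mod_cast le_add_of_nonneg_right (Nat.cast_nonneg n))
      filter_upwards [h1, hval] with ω h1 h2 hω
      have h3 := h1 hω
      rwa [h2, ← sub_sub] at h3
    filter_upwards [ae_all_iff.2 h] with ω h hω
    exact nonpos_of_forall_nat_le fun n => h n hω
  · have hA : MeasurableSet {ω | k y ω < ⊤} :=
      measurableSet_lt (L0bar.measurable _) measurable_const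
    -- Replacing `y` by `y₁` where `k y = ⊤` gives a point that is finite on all of `C` and agrees
    -- with `y` where the claim is made.
    set y' : E := ind P hA • y + (1 - ind P hA) • y₁ with hy'
    have h := hsep y' (k y').toReal (by
      filter_upwards [hy₁, hk.isLocal.glue_mem hA y y₁, hk.isLocal.glue_notMem hA y y₁,
        (k y').toReal_ae] with ω h1 h2 h3 h4 hω
      rw [h4]
      refine EReal.le_coe_toReal ?_
      by_cases hωA : ω ∈ {ω | k y ω < ⊤}
      · rw [h2 hωA]; exact (show k y ω < ⊤ from hωA).ne
      · rw [h3 hωA]; exact (h1 hω).ne)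
    have hGy := map_ind_smul_ae G hA y'
    rw [hy', ind_smul_glue, ← hy'] at hGy
    filter_upwards [h, hk.isLocal.glue_mem hA y y₁, (k y').toReal_ae, hGy,
      map_ind_smul_ae G hA y] with ω h1 h2 h3 h4 h5 hω hωA
    have h6 := h1 hω
    rwa [h3, h2 hωA, ← h4 hωA, h5 hωA] at h6

/-- An affine minorant of a minorant of `f` is a minorant of the biconjugate of `f`. -/
theorem affine_le_biconj [IsFiniteMeasure P] {𝒮 : Set (E → L0 P)} {f k : E → L0bar P}
    (hkf : k ≤ f) {D : Set Ω} (hD : MeasurableSet D) {g : E →ₗ[L0 P] L0 P}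
    (hg : g ∈ randomConjugate 𝒮) {c : L0 P}
    (h : ∀ y, ∀ᵐ ω ∂P, ω ∈ D → ((g y ω - c ω : ℝ) : EReal) ≤ k y ω) (x : E) :
    ∀ᵐ ω ∂P, ω ∈ D → ((g x ω - c ω : ℝ) : EReal) ≤ biconj 𝒮 f x ω := by
  have h1 := conj_le_on (f := f) (g := g) (η := c.toBar) hD fun y => by
    filter_upwards [h y, AEEqFun.coeFn_le.2 (hkf y), c.toBar_ae] with ω h1 h2 h3 hω
    rw [h3]
    refine coe_sub_le_comm ?_
    rw [← EReal.coe_sub]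
    exact (h1 hω).trans h2
  filter_upwards [h1, c.toBar_ae, le_biconj f hg x] with ω h1 h2 h3 hω
  have h4 := h1 hω
  rw [h2] at h4
  rw [EReal.coe_sub]
  exact (EReal.sub_le_sub le_rfl h4).trans h3

theorem coe_le_of_lt_top_imp {a : ℝ} {b : EReal} (hb : ⊥ < b) (h : b < ⊤ → a ≤ b.toReal) :
    (a : EReal) ≤ b := by
  induction b with
  | bot => exact absurd hb (lt_irrefl _)
  | top => exact le_top
  | coe b => exact_mod_cast h (EReal.coe_lt_top b)

/-- A closed function that is proper on `B` cannot exceed the real `q` on `B` if the biconjugate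
of a majorant is smaller than `q` there. -/
theorem IsClosedFunction.false_of_biconj_lt [IsProbabilityMeasure P] {𝒮 : Set (E → L0 P)}
    (h𝒮 : ∀ p ∈ 𝒮, IsL0Seminorm p) {f k : E → L0bar P} (hk : IsClosedFunction 𝒮 k) (hkf : k ≤ f)
    {B : Set Ω} (hB : MeasurableSet B) (hBk : B ⊆ BP k) (hPB : 0 < P B) {y₁ : E}
    (hy₁ : ∀ᵐ ω ∂P, ω ∈ B → k y₁ ω < ⊤) (hbot : ∀ y, ∀ᵐ ω ∂P, ω ∈ B → ⊥ < k y ω) {x : E}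
    {q : ℝ} (hq : ∀ᵐ ω ∂P, ω ∈ B → (q : EReal) < k x ω)
    (hq' : ∀ᵐ ω ∂P, ω ∈ B → biconj 𝒮 f x ω < q) : False := by
  -- an affine minorant on part of `B` with value at least `q` at `x` is impossible
  have key : ∀ D ⊆ B, MeasurableSet D → 0 < P D → ∀ g : E →ₗ[L0 P] L0 P, IsDominated 𝒮 g →
      ∀ c : L0 P, (∀ y, ∀ᵐ ω ∂P, ω ∈ D → k y ω < ⊤ → g y ω - c ω ≤ (k y ω).toReal) →
      (∀ᵐ ω ∂P, ω ∈ D → q ≤ g x ω - c ω) → False := by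
    intro D hDB hD hPD g hg c h1 h2
    have h3 := affine_le_biconj (𝒮 := 𝒮) hkf hD (hg.mem_randomConjugate h𝒮) (c := c)
      (fun y => by
        filter_upwards [h1 y, hbot y] with ω h1 h2 hω
        exact coe_le_of_lt_top_imp (h2 (hDB hω)) (h1 hω)) x
    refine hPD.ne' (measure_eq_zero_iff_ae_notMem.2 ?_)
    filter_upwards [h2, h3, hq'] with ω h2 h3 h4 hω
    have h5 : ((g x ω - c ω : ℝ) : EReal) < q := (h3 hω).trans_lt (h4 (hDB hω))
    exact absurd (h2 hω) (not_le.2 (by exact_mod_cast h5))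
  obtain ⟨D, hDB, hD, hPD, G, hG, β, ε, hε, hβ, hsep⟩ :=
    hk.exists_separating h𝒮 hB hBk hPB hy₁ hbot (x := x) (r := L0.const P q) (by
      filter_upwards [hq, L0.const_ae (P := P) q] with ω h1 h2 hω
      rw [h2]
      exact h1 hω)
  have hNm : MeasurableSet {ω | β ω < 0} := measurableSet_lt (L0.measurable _) measurable_const
  rcases eq_zero_or_pos (P (D ∩ {ω | β ω < 0})) with h0 | h0
  -- Vertical case: only `G y ≤ G x - ε` on the domain of `k` is known, with no information about
  -- heights.
  · have hβ0 : ∀ᵐ ω ∂P, ω ∈ D → β ω = 0 := by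
      filter_upwards [measure_eq_zero_iff_ae_notMem.1 h0, hβ] with ω h1 h2 hω
      exact le_antisymm (h2 hω) (not_lt.1 fun h3 => h1 ⟨hω, h3⟩)
    -- an affine minorant on a part of `D`, from the point `(y₁, k y₁ - 1)`
    have hr₂ : ∀ᵐ ω ∂P, ((k y₁).toReal - 1) ω = (k y₁ ω).toReal - 1 := by
      filter_upwards [L0.sub_ae (k y₁).toReal 1, (k y₁).toReal_ae, L0.one_ae (P := P)]
        with ω h1 h2 h3
      rw [h1, h2, h3]
    obtain ⟨D₂, hD₂D, hD₂, hPD₂, G₂, hG₂, β₂, ε₂, hε₂, -, hsep₂⟩ :=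
      hk.exists_separating h𝒮 hD (hDB.trans hBk) hPD
        (hy₁.mono fun ω h hω => h (hDB hω)) (fun y => (hbot y).mono fun ω h hω => h (hDB hω))
        (x := y₁) (r := (k y₁).toReal - 1) (by
          filter_upwards [hy₁, hbot y₁, hr₂] with ω h1 h2 h3 hω
          rw [h3]
          rw [← EReal.coe_toReal (h1 (hDB hω)).ne (h2 (hDB hω)).ne', EReal.toReal_coe]
          exact_mod_cast sub_one_lt _)
    -- Taking `y = y₁` in the second separation gives `ε₂ ≤ -β₂`, so division by `-β₂` is legitimate
    -- on `D₂` and `ξ • G₂ - c₂` is a minorant there. Adding `n * (G y - G x + ε)`, nonpositive on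
    -- the domain, keeps it one; at `x` this adds `n * ε`, and `n` is chosen to make that at least
    -- the gap to `q`.
    let ξ : L0 P := L0.inv (-β₂)
    let c₂ : L0 P := ξ * (G₂ y₁ - L0.const P ε₂) - ((k y₁).toReal - 1)
    let n : L0 P := L0.const P ε⁻¹ * |L0.const P q - ξ * G₂ x + c₂|
    have hξ : ∀ᵐ ω ∂P, ω ∈ D₂ → β₂ ω < 0 ∧ ξ ω = (-β₂ ω)⁻¹ := by
      filter_upwards [hsep₂ y₁, hy₁, hr₂, L0.inv_ae (-β₂), L0.neg_ae β₂] with ω h1 h2 h3 h4 h5 hω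
      refine ⟨?_, by rw [h4, h5]⟩
      have h6 := h1 hω (h2 (hDB (hD₂D hω)))
      rw [h3] at h6
      linarith
    have hc₂ : ∀ᵐ ω ∂P, c₂ ω = ξ ω * (G₂ y₁ ω - ε₂) - ((k y₁).toReal - 1) ω := by
      filter_upwards [L0.sub_ae (ξ * (G₂ y₁ - L0.const P ε₂)) ((k y₁).toReal - 1),
        L0.mul_ae ξ (G₂ y₁ - L0.const P ε₂), L0.sub_ae (G₂ y₁) (L0.const P ε₂),
        L0.const_ae (P := P) ε₂] with ω h1 h2 h3 h4
      rw [h1, h2, h3, h4]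
    have hn : ∀ᵐ ω ∂P, n ω = ε⁻¹ * |q - ξ ω * G₂ x ω + c₂ ω| := by
      filter_upwards [L0.mul_ae (L0.const P ε⁻¹) |L0.const P q - ξ * G₂ x + c₂|,
        L0.const_ae (P := P) ε⁻¹, L0.abs_ae (L0.const P q - ξ * G₂ x + c₂),
        L0.add_ae (L0.const P q - ξ * G₂ x) c₂, L0.sub_ae (L0.const P q) (ξ * G₂ x),
        L0.const_ae (P := P) q, L0.mul_ae ξ (G₂ x)] with ω h1 h2 h3 h4 h5 h6 h7
      rw [h1, h2, h3, h4, h5, h6, h7]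
    have hg : ∀ y, ∀ᵐ ω ∂P, (ξ • G₂ + n • G) y ω = ξ ω * G₂ y ω + n ω * G y ω := fun y => by
      filter_upwards [L0.add_ae (ξ * G₂ y) (n * G y), L0.mul_ae ξ (G₂ y), L0.mul_ae n (G y)]
        with ω h1 h2 h3
      rw [← h2, ← h3, ← h1]
      rfl
    have hc : ∀ᵐ ω ∂P, (c₂ + n * (G x - L0.const P ε)) ω = c₂ ω + n ω * (G x ω - ε) := by
      filter_upwards [L0.add_ae c₂ (n * (G x - L0.const P ε)),
        L0.mul_ae n (G x - L0.const P ε), L0.sub_ae (G x) (L0.const P ε),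
        L0.const_ae (P := P) ε] with ω h1 h2 h3 h4
      rw [h1, h2, h3, h4]
    refine key D₂ (hD₂D.trans hDB) hD₂ hPD₂ (ξ • G₂ + n • G) ((hG₂.smul ξ).add h𝒮 (hG.smul n))
      (c₂ + n * (G x - L0.const P ε)) (fun y => ?_) ?_
    · filter_upwards [hsep y, hsep₂ y, hξ, hc₂, hn, hg y, hc, hβ0] with ω h1 h2 h3 h4 h5 h6 h7 h8
        hω hky
      have e1 := h1 (hD₂D hω) hky
      have e2 := h2 hω hky
      obtain ⟨e3, e4⟩ := h3 hω
      rw [h8 (hD₂D hω), zero_mul, add_zero] at e1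
      have hnn : 0 ≤ n ω := by rw [h5]; positivity
      have hξ0 : 0 ≤ ξ ω := by rw [e4]; exact inv_nonneg.2 (by linarith)
      have hξβ : ξ ω * β₂ ω = -1 := by
        rw [e4, inv_neg, neg_mul, inv_mul_cancel₀ e3.ne]
      have e5 := mul_le_mul_of_nonneg_left e1 hnn
      have e6 := mul_le_mul_of_nonneg_left e2 hξ0
      rw [mul_add, ← mul_assoc, hξβ] at e6
      rw [h6, h7, h4]
      linarith
    · filter_upwards [hn, hg x, hc] with ω h1 h2 h3 hω
      rw [h2, h3]
      have e1 : n ω * ε = |q - ξ ω * G₂ x ω + c₂ ω| := by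
        rw [h1]; field_simp
      have e2 := le_abs_self (q - ξ ω * G₂ x ω + c₂ ω)
      linarith
  -- Nonvertical case: division by `-β` gives a minorant with value `q + ξ * ε` at `x`.
  · let ξ : L0 P := L0.inv (-β)
    have hξ : ∀ᵐ ω ∂P, ξ ω = (-β ω)⁻¹ := by
      filter_upwards [L0.inv_ae (-β), L0.neg_ae β] with ω h1 h2
      rw [h1, h2]
    have hg : ∀ y, ∀ᵐ ω ∂P, (ξ • G) y ω = ξ ω * G y ω := fun y => L0.mul_ae ξ (G y)
    have hc : ∀ᵐ ω ∂P, (ξ * (G x - L0.const P ε) - L0.const P q) ω = ξ ω * (G x ω - ε) - q := by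
      filter_upwards [L0.sub_ae (ξ * (G x - L0.const P ε)) (L0.const P q),
        L0.mul_ae ξ (G x - L0.const P ε), L0.sub_ae (G x) (L0.const P ε),
        L0.const_ae (P := P) ε, L0.const_ae (P := P) q] with ω h1 h2 h3 h4 h5
      rw [h1, h2, h3, h4, h5]
    refine key (D ∩ {ω | β ω < 0}) (Set.inter_subset_left.trans hDB) (hD.inter hNm) h0 (ξ • G)
      (hG.smul ξ) (ξ * (G x - L0.const P ε) - L0.const P q) (fun y => ?_) ?_
    · filter_upwards [hsep y, hξ, hg y, hc, L0.const_ae (P := P) q] with ω h1 h2 h3 h4 h5 hω hky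
      have e2 := h1 hω.1 hky
      have e3 : β ω < 0 := hω.2
      have hξ0 : 0 ≤ ξ ω := by rw [h2]; exact inv_nonneg.2 (by linarith)
      have hξβ : ξ ω * β ω = -1 := by
        rw [h2, inv_neg, neg_mul, inv_mul_cancel₀ e3.ne]
      have e6 := mul_le_mul_of_nonneg_left e2 hξ0
      rw [mul_add, ← mul_assoc, hξβ, h5] at e6
      rw [h3, h4]
      linarith
    · filter_upwards [hξ, hg x, hc] with ω h1 h2 h3 hω
      have e3 : β ω < 0 := hω.2
      have hξ0 : 0 ≤ ξ ω := by rw [h1]; exact inv_nonneg.2 (by linarith)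
      have e4 := mul_nonneg hξ0 hε.le
      rw [h2, h3]
      linarith

theorem zero_mem_randomConjugate [IsProbabilityMeasure P] {𝒮 : Set (E → L0 P)}
    (h𝒮 : ∀ p ∈ 𝒮, IsL0Seminorm p) : (0 : E →ₗ[L0 P] L0 P) ∈ randomConjugate 𝒮 :=
  IsDominated.mem_randomConjugate h𝒮 ⟨∅, by simp, 0, le_rfl, fun x => by simp⟩

/-- The functional `g = 0` alone suffices: its conjugate is `-∞` on `A`. -/
theorem biconj_eq_top_of_forall_eq_top [IsProbabilityMeasure P] {𝒮 : Set (E → L0 P)}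
    (h𝒮 : ∀ p ∈ 𝒮, IsL0Seminorm p) {f : E → L0bar P} {A : Set Ω} (hA : MeasurableSet A)
    (h : ∀ y, ∀ᵐ ω ∂P, ω ∈ A → f y ω = ⊤) (x : E) :
    ∀ᵐ ω ∂P, ω ∈ A → biconj 𝒮 f x ω = ⊤ := by
  have h1 := conj_le_on (f := f) (g := 0) (η := AEEqFun.const Ω ⊥) hA fun y => by
    filter_upwards [h y] with ω h1 hω
    rw [h1 hω]
    simp
  filter_upwards [h1, AEEqFun.coeFn_const (μ := P) Ω (⊥ : EReal),
    le_biconj f (zero_mem_randomConjugate h𝒮) x] with ω h1 h2 h3 hω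
  have h4 := h1 hω
  rw [h2] at h4
  rw [le_bot_iff.1 h4] at h3
  simpa using h3

/-- Closed minorants of `f` are minorants of the biconjugate of `f`. -/
theorem IsClosedFunction.le_biconj [IsProbabilityMeasure P] {𝒮 : Set (E → L0 P)}
    (h𝒮 : ∀ p ∈ 𝒮, IsL0Seminorm p) {f k : E → L0bar P} (hk : IsClosedFunction 𝒮 k)
    (hkf : k ≤ f) : k ≤ biconj 𝒮 f := by
  intro x
  rw [← AEEqFun.coeFn_le]
  have hMI := isEssSup_MI k
  have hPI := isEssSup_PI k
  have hPItop : ∀ y, ∀ᵐ ω ∂P, ω ∈ PI k → k y ω = ⊤ := fun y =>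
    hPI.2.2 {ω | k y ω = ⊤} (L0bar.measurable _ (measurableSet_singleton _))
      fun A hA => hA.2 y
  have hPIb : ∀ᵐ ω ∂P, ω ∈ PI k → biconj 𝒮 f x ω = ⊤ :=
    biconj_eq_top_of_forall_eq_top h𝒮 hPI.1 (fun y => by
      filter_upwards [hPItop y, AEEqFun.coeFn_le.2 (hkf y)] with ω h1 h2 hω
      rw [h1 hω] at h2
      exact top_le_iff.1 h2) x
  have hBPm : MeasurableSet (BP k) := (hMI.1.union hPI.1).compl
  have hbot : ∀ y, ∀ᵐ ω ∂P, ω ∈ BP k → ⊥ < k y ω := fun y => by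
    have h := hMI.2.1 {ω | k y ω = ⊥} ⟨L0bar.measurable _ (measurableSet_singleton _), y,
      Filter.Eventually.of_forall fun ω hω => hω⟩
    filter_upwards [h] with ω h hω
    exact bot_lt_iff_ne_bot.2 fun h' => hω (Or.inl (h h'))
  -- Rational levels reduce a strict inequality between two random variables to countably many null
  -- sets.
  have hnull : ∀ q : ℚ, P {ω | ω ∈ BP k ∧ biconj 𝒮 f x ω < ((q : ℝ) : EReal) ∧
      ((q : ℝ) : EReal) < k x ω} = 0 := by
    intro q
    by_contra hne
    set B : Set Ω := {ω | ω ∈ BP k ∧ biconj 𝒮 f x ω < ((q : ℝ) : EReal) ∧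
      ((q : ℝ) : EReal) < k x ω} with hBdef
    have hB : MeasurableSet B := by
      have h1 : MeasurableSet {ω | biconj 𝒮 f x ω < ((q : ℝ) : EReal)} :=
        measurableSet_lt (L0bar.measurable _) measurable_const
      have h2 : MeasurableSet {ω | ((q : ℝ) : EReal) < k x ω} :=
        measurableSet_lt measurable_const (L0bar.measurable _)
      exact hBPm.inter (h1.inter h2)
    -- Otherwise every `k y` is `⊤` on `B`, which would put `B` inside `PI k` up to a null set.
    obtain ⟨y₁, hy₁⟩ : ∃ y, P (B ∩ {ω | k y ω < ⊤}) ≠ 0 := by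
      by_contra! hcon
      have h := hPI.2.1 B ⟨hB, fun y => by
        filter_upwards [measure_eq_zero_iff_ae_notMem.1 (hcon y)] with ω h1 hω
        by_contra h2
        exact h1 ⟨hω, lt_top_iff_ne_top.2 h2⟩⟩
      refine hne (measure_eq_zero_iff_ae_notMem.2 ?_)
      filter_upwards [h] with ω h hω
      exact hω.1 (Or.inr (h hω))
    refine hk.false_of_biconj_lt h𝒮 hkf (B := B ∩ {ω | k y₁ ω < ⊤}) (x := x) (q := q)
      (hB.inter (measurableSet_lt (L0bar.measurable _) measurable_const))
      (fun ω hω => hω.1.1) (pos_iff_ne_zero.2 hy₁) (y₁ := y₁)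
      (Filter.Eventually.of_forall fun ω hω => hω.2)
      (fun y => (hbot y).mono fun ω h hω => h hω.1.1)
      (Filter.Eventually.of_forall fun ω hω => hω.1.2.2)
      (Filter.Eventually.of_forall fun ω hω => hω.1.2.1)
  filter_upwards [hPIb, hk.eq_bot x,
    ae_all_iff.2 fun q => measure_eq_zero_iff_ae_notMem.1 (hnull q)] with ω h1 h2 h3
  by_cases hM : ω ∈ MI k
  · rw [h2 hM]; exact bot_le
  by_cases hPω : ω ∈ PI k
  · rw [h1 hPω]; exact le_top
  by_contra hlt
  obtain ⟨q, hq1, hq2⟩ := EReal.lt_iff_exists_rat_btwn.1 (not_le.1 hlt)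
  exact h3 q ⟨fun h => h.elim hM hPω, hq1, hq2⟩

end FenchelMoreau

end RLC

end

theorem theorem5p14 {Ω : Type*} [MeasurableSpace Ω] (P : MeasureTheory.Measure Ω)
    [MeasureTheory.IsProbabilityMeasure P] {E : Type*} [AddCommGroup E] [Module (RLC.L0 P) E]
    (𝒮 : Set (E → RLC.L0 P)) (h𝒮 : RLC.IsRLCModule 𝒮)
    (f : E → RLC.L0bar P) (hf : RLC.IsLocal f) :
    RLC.IsEpsLamClosure 𝒮 f (RLC.biconj 𝒮 f) :=
  ⟨⟨RLC.isClosedFunction_biconj 𝒮 f, RLC.biconj_le 𝒮 f⟩,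
    fun _ hk => hk.1.le_biconj h𝒮.seminorm hk.2⟩
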